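/- **Conventions.** A diffeological space is a set $X$ with a specified set of functions (plots) $U\to X$, for $U$ open in some $\mathbb{R}^n$, containing the constants, closed under precomposition with smooth maps and satisfying the sheaf condition; a map is smooth if it sends plots to plots. Subsets carry the sub-diffeology and products the product diffeology. A *diffeological bundle with fiber $F$* is a smooth map $\pi:E\to B$ such that for every plot $p:U\to B$ the pullback $p^*\pi$ is locally trivial with fiber $F$: there is an open cover $U=\bigcup_i U_i$ such that each restriction of $p^*\pi$ to $U_i$ is diffeomorphic, over $U_i$, to $U_i\times F$. A *subduction* $X\to Y$ is a map such that the plots of $Y$ are exactly the functions that locally lift to plots of $X$. A *pointed plot* of $(X,x)$ is a plot $p:U\to X$ with $p(0)=x$, where $U$ is a connected open neighbourhood of $0$ in some $\mathbb{R}^n$; a morphism from $p:U\to X$ to $q:V\to X$ is a smooth map $f:U\to V$ with $f(0)=0$ and $q\circ f=p$. The *internal tangent space* $T_x(X)$ is the colimit of the real vector spaces $T_0(U)$ over the category of pointed plots of $(X,x)$; it is functorial in smooth pointed maps. The *germ category* of $(X,x)$ has the same objects, with morphisms from $p$ to $q$ the germs at $0$ of smooth maps $f:W\to V$ with $f(0)=0$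 and $q\circ f=p|_W$, where $W$ is an open neighbourhood of $0$ in $U$. The pointed space $(X,x)$ is *filtered* if its germ category is filtered (non-empty, any two objects map to a common object, and any two parallel morphisms are equalized by some morphism out of their target). The tangent bundle is $TX=\bigsqcup_{x\in X}T_x(X)$. *Hector's diffeology* on $TX$ is generated by the maps $Tq:TV=V\times\mathbb{R}^n\to TX$ for all plots $q:V\to X$ with $V$ a connected open subset of some $\mathbb{R}^n$. The *dvs diffeology* on $TX$ is the smallest diffeology containing Hector's diffeology for which the projection $TX\to X$, the zero section $X\to TX$, the fiberwise addition $TX\times_X TX\to TX$ and the scalar multiplication $\mathbb{R}\times TX\to TX$ are smooth. Write $T^H_x(X)$ and $T^{dvs}_x(X)$ for $T_x(X)$ with the corresponding sub-diffeologies. **Theorem.** Let $\pi:E\to B$ be a diffeological bundle, let $e\in E$ and $b=\pi(e)$, and let $\iota:\pi^{-1}(b)\to E$ be the inclusion of the fiber $F_b=\pi^{-1}(b)$, with the sub-diffeology. If $(E,e)$ and $(B,b)$ are filtered, then $$0\longrightarrow T_e(F_b)\xrightarrow{\ \iota_*\ }T_e(E)\xrightarrow{\ \pi_*\ }T_b(B)\longrightarrow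 0$$ is an exact sequence of vector spaces (in particular $\iota_*$ is injective). Moreover, both $\pi_*:T^H_e(E)\to T^H_b(B)$ and $\pi_*:T^{dvs}_e(E)\to T^{dvs}_b(B)$ are subductions. -/

import Mathlib

noncomputable section

open scoped ContDiff Topology
open Diffeology CategoryTheory

namespace DiffTangent

universe u v w

/-- The Euclidean space `ℝⁿ`. -/
abbrev Euc (n : ℕ) : Type := EuclideanSpace ℝ (Fin n)

section Diffeologies

/-- The diffeology induced by a function `f : A → X`: a map into `A` is a plot when its composite
with `f` is a plot of `X`. -/
@[reducible]
def inducedDiffeology {A : Type u} {X : Type v} (f : A → X) (d : DiffeologicalSpace X) :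
    DiffeologicalSpace A where
  plots n := {p | IsPlot (fun t : Euc n => f (p t))}
  constant_plots a := isPlot_const (x := f a)
  plot_reparam hp hg := isPlot_reparam hp hg
  locality {n} {p} hp := d.locality (n := n) (p := fun t => f (p t)) fun x => by
    obtain ⟨W, hW, hx, h⟩ := hp x
    exact ⟨W, hW, hx, fun {m} {g} hg hg' => h hg hg'⟩

/-- The sub-diffeology on a subset. -/
instance subDiffeology {X : Type u} [d : DiffeologicalSpace X] (P : X → Prop) :
    DiffeologicalSpace {x // P x} :=
  inducedDiffeology Subtype.val d

/-- The product diffeology: a map is a plot when both of its components are. -/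
instance prodDiffeology {X : Type u} {Y : Type v} [dX : DiffeologicalSpace X]
    [dY : DiffeologicalSpace Y] : DiffeologicalSpace (X × Y) where
  plots n := {p | IsPlot (fun t : Euc n => (p t).1) ∧ IsPlot (fun t : Euc n => (p t).2)}
  constant_plots a := ⟨isPlot_const (x := a.1), isPlot_const (x := a.2)⟩
  plot_reparam hp hg := ⟨isPlot_reparam hp.1 hg, isPlot_reparam hp.2 hg⟩
  locality {n} {p} hp :=
    ⟨dX.locality (n := n) (p := fun t => (p t).1) fun x => by
      obtain ⟨W, hW, hx, h⟩ := hp x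
      exact ⟨W, hW, hx, fun {m} {g} hg hg' => (h hg hg').1⟩,
    dY.locality (n := n) (p := fun t => (p t).2) fun x => by
      obtain ⟨W, hW, hx, h⟩ := hp x
      exact ⟨W, hW, hx, fun {m} {g} hg hg' => (h hg hg').2⟩⟩

/-- A subduction: the plots of `Y` are exactly the functions that locally lift along `f` to plots
of `X`. (A plot with open domain `W ⊆ ℝⁿ` is a smooth function on `W` with its sub-diffeology.) -/
def IsSubduction {X : Type u} {Y : Type v} (dX : DiffeologicalSpace X) (dY : DiffeologicalSpace Y)
    (f : X → Y) : Prop :=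
  ∀ (n : ℕ) (p : Euc n → Y), IsPlot p ↔
    ∀ t : Euc n, ∃ W : Set (Euc n), IsOpen W ∧ t ∈ W ∧
      ∃ q : W → X, DSmooth q ∧ ∀ s : W, f (q s) = p s

end Diffeologies

section Bundles

/-- `f : Z → U` is locally trivial with fiber `F`: every point of `U` has an open neighbourhood `W`
over which `f` is diffeomorphic, over `W`, to the projection `W × F → W`. -/
def IsLocallyTrivial (F : Type w) {Z : Type v} {U : Type u} [DiffeologicalSpace F]
    [DiffeologicalSpace Z] [TopologicalSpace U] [DiffeologicalSpace U] (f : Z → U) : Prop :=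
  ∀ t : U, ∃ W : Set U, IsOpen W ∧ t ∈ W ∧
    ∃ φ : {z : Z // f z ∈ W} ≃ {s : U // s ∈ W} × F,
      DSmooth φ ∧ DSmooth φ.symm ∧ ∀ z, (φ z).1.1 = f z.1

/-- A diffeological bundle with fiber `F`: a smooth map whose pullback along every plot `p : U → Y`
(with `U` open in some `ℝⁿ`) is locally trivial with fiber `F`. The pullback is the subspace
`{(t, x) | p t = f x}` of `U × X`, with the projection to `U`. -/
structure IsDiffeologicalBundle (F : Type w) {X : Type u} {Y : Type v} [DiffeologicalSpace F]
    [DiffeologicalSpace X] [DiffeologicalSpace Y] (f : X → Y) : Prop where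
  smooth : DSmooth f
  locallyTrivial : ∀ (n : ℕ) (U : Set (Euc n)), IsOpen U → ∀ p : U → Y, DSmooth p →
    IsLocallyTrivial F (fun z : {z : U × X // p z.1 = f z.2} => z.1.1)

end Bundles

section TangentSpaces

/-- A pointed plot `(U, 0) → (X, x)`, where `U` is a connected open neighbourhood of `0` in some
`ℝⁿ`: an object of the category of plots of `X` centered at `x`. -/
structure PointedPlot (X : Type u) [DiffeologicalSpace X] (x : X) where
  dim : ℕ
  dom : Set (Euc dim)
  isOpen_dom : IsOpen dom
  isConnected_dom : IsConnected dom
  zero_mem : (0 : Euc dim) ∈ dom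
  toFun : dom → X
  smooth : DSmooth toFun
  map_zero : toFun ⟨0, zero_mem⟩ = x

namespace PointedPlot

variable {X : Type u} [DiffeologicalSpace X] {x : X} {Y : Type v} [DiffeologicalSpace Y] {y : Y}

/-- `f` restricts to a morphism from `p` to `q` in the category of plots centered at `x`: a smooth
map from the domain of `p` to the domain of `q`, with `f 0 = 0` and `q ∘ f = p`. (Values of `f`
outside the domain of `p` play no role.) -/
structure IsMorphism (p q : PointedPlot X x) (f : Euc p.dim → Euc q.dim) : Prop where
  contDiffOn : ContDiffOn ℝ ∞ f p.dom
  map_zero : f 0 = 0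
  comm : ∀ t : p.dom, ∃ h : f t ∈ q.dom, q.toFun ⟨f t, h⟩ = p.toFun t

/-- Composition of a pointed plot with a smooth pointed map `(X, x) → (Y, y)`. -/
def push (f : X → Y) (hf : DSmooth f) (hxy : f x = y) (p : PointedPlot X x) :
    PointedPlot Y y where
  dim := p.dim
  dom := p.dom
  isOpen_dom := p.isOpen_dom
  isConnected_dom := p.isConnected_dom
  zero_mem := p.zero_mem
  toFun := fun t => f (p.toFun t)
  smooth := hf.comp p.smooth
  map_zero := by rw [p.map_zero, hxy]

end PointedPlot

open Classical in
/-- The relations `(p, a) = (q, f_* a)` of the colimit defining the tangent space, for the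
morphisms `f` from `p` to `q`, where `f_* a` is the image of `a ∈ T₀U = ℝⁿ` under the derivative of
`f` at `0`. -/
def tangentRelations (X : Type u) [DiffeologicalSpace X] (x : X) :
    Submodule ℝ (DirectSum (PointedPlot X x) fun p => Euc p.dim) :=
  Submodule.span ℝ
    {r | ∃ (p q : PointedPlot X x) (f : Euc p.dim → Euc q.dim) (a : Euc p.dim),
      p.IsMorphism q f ∧
        r = DirectSum.lof ℝ (PointedPlot X x) (fun p => Euc p.dim) p a -
          DirectSum.lof ℝ (PointedPlot X x) (fun p => Euc p.dim) q (fderiv ℝ f 0 a)}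

/-- The internal tangent space `T_x X`: the colimit in real vector spaces of `T₀U`, over the category
of pointed plots `(U, 0) → (X, x)`. -/
def TangentSp (X : Type u) [DiffeologicalSpace X] (x : X) : Type u :=
  (DirectSum (PointedPlot X x) fun p => Euc p.dim) ⧸ tangentRelations X x

namespace TangentSp

variable {X : Type u} [DiffeologicalSpace X] {x : X} {Y : Type v} [DiffeologicalSpace Y] {y : Y}

instance : AddCommGroup (TangentSp X x) :=
  inferInstanceAs (AddCommGroup (_ ⧸ tangentRelations X x))

instance : Module ℝ (TangentSp X x) :=
  inferInstanceAs (Module ℝ (_ ⧸ tangentRelations X x))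

open Classical in
/-- The element `p_* a` of `T_x X` represented by a pointed plot `p` and a vector `a ∈ T₀U`. -/
def mk (p : PointedPlot X x) : Euc p.dim →ₗ[ℝ] TangentSp X x :=
  (tangentRelations X x).mkQ ∘ₗ DirectSum.lof ℝ (PointedPlot X x) (fun p => Euc p.dim) p

theorem mk_eq {p q : PointedPlot X x} {f : Euc p.dim → Euc q.dim} (hf : p.IsMorphism q f)
    (a : Euc p.dim) : mk p a = mk q (fderiv ℝ f 0 a) := by
  classical
  refine (Submodule.Quotient.eq (tangentRelations X x)).2 (Submodule.subset_span ?_)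
  exact ⟨p, q, f, a, hf, by congr⟩

/-- The universal property of the colimit (existence). -/
def lift {M : Type w} [AddCommGroup M] [Module ℝ M] (g : ∀ p : PointedPlot X x, Euc p.dim →ₗ[ℝ] M)
    (hg : ∀ (p q : PointedPlot X x) (f : Euc p.dim → Euc q.dim), p.IsMorphism q f →
      ∀ a, g p a = g q (fderiv ℝ f 0 a)) : TangentSp X x →ₗ[ℝ] M := by
  classical
  refine (tangentRelations X x).liftQ (DirectSum.toModule ℝ (PointedPlot X x) M g) ?_
  refine Submodule.span_le.2 ?_
  rintro _ ⟨p, q, f, a, hf, rfl⟩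
  have h1 := DirectSum.toModule_lof ℝ (φ := g) p a
  have h2 := DirectSum.toModule_lof ℝ (φ := g) q (fderiv ℝ f 0 a)
  have h3 := hg p q f hf a
  rw [SetLike.mem_coe, LinearMap.mem_ker, map_sub, sub_eq_zero]
  convert h1.trans (h3.trans h2.symm) using 3

theorem lift_mk {M : Type w} [AddCommGroup M] [Module ℝ M]
    (g : ∀ p : PointedPlot X x, Euc p.dim →ₗ[ℝ] M)
    (hg : ∀ (p q : PointedPlot X x) (f : Euc p.dim → Euc q.dim), p.IsMorphism q f →
      ∀ a, g p a = g q (fderiv ℝ f 0 a)) (p : PointedPlot X x) (a : Euc p.dim) :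
    lift g hg (mk p a) = g p a := by
  classical
  have h1 := DirectSum.toModule_lof ℝ (φ := g) p a
  refine Eq.trans ?_ h1
  exact congrArg _ (by congr)

/-- The universal property of the colimit (uniqueness). -/
theorem hom_ext {M : Type w} [AddCommGroup M] [Module ℝ M] {g h : TangentSp X x →ₗ[ℝ] M}
    (H : ∀ (p : PointedPlot X x) (a : Euc p.dim), g (mk p a) = h (mk p a)) : g = h := by
  classical
  refine Submodule.linearMap_qext _ (DirectSum.linearMap_ext ℝ fun p => LinearMap.ext fun a => ?_)
  exact H p a

/-- The linear map `f_* : T_x X → T_y Y` induced by a smooth pointed map `f : (X, x) → (Y, y)`;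
it sends `p_* a` to `(f ∘ p)_* a`. -/
def map (f : X → Y) (hf : DSmooth f) (hxy : f x = y) : TangentSp X x →ₗ[ℝ] TangentSp Y y :=
  lift (fun p => mk (p.push f hf hxy)) fun p q _ hg a =>
    mk_eq (p := p.push f hf hxy) (q := q.push f hf hxy)
      ⟨hg.contDiffOn, hg.map_zero, fun t => (hg.comm t).imp fun _ h => congrArg f h⟩ a

theorem map_mk (f : X → Y) (hf : DSmooth f) (hxy : f x = y) (p : PointedPlot X x)
    (a : Euc p.dim) : map f hf hxy (mk p a) = mk (p.push f hf hxy) a :=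
  lift_mk _ _ p a

end TangentSp

end TangentSpaces

section GermCategory

/-- The objects of the germ category of `(X, x)`: the pointed plots. -/
structure GermCat (X : Type u) [DiffeologicalSpace X] (x : X) where
  plot : PointedPlot X x

namespace GermCat

variable {X : Type u} [DiffeologicalSpace X] {x : X}

/-- `f` represents a germ at `0` of a morphism from `p` to `q`: on an open neighbourhood `W` of `0`
in the domain of `p` it is a smooth map to the domain of `q` with `f 0 = 0` and `q ∘ f = p`. -/
def IsGermMap (p q : PointedPlot X x) (f : Euc p.dim → Euc q.dim) : Prop :=
  f 0 = 0 ∧ ∃ W : Set (Euc p.dim), IsOpen W ∧ 0 ∈ W ∧ W ⊆ p.dom ∧ ContDiffOn ℝ ∞ f W ∧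
    ∀ t : p.dom, t.1 ∈ W → ∃ h : f t ∈ q.dom, q.toFun ⟨f t, h⟩ = p.toFun t

/-- Two representatives are equivalent if they agree on a neighbourhood of `0`. -/
instance germSetoid (p q : PointedPlot X x) :
    Setoid {f : Euc p.dim → Euc q.dim // IsGermMap p q f} where
  r f g := f.1 =ᶠ[𝓝 0] g.1
  iseqv := ⟨fun _ => Filter.EventuallyEq.rfl, fun h => h.symm, fun h k => h.trans k⟩

theorem IsGermMap.id (p : PointedPlot X x) : IsGermMap p p _root_.id :=
  ⟨rfl, p.dom, p.isOpen_dom, p.zero_mem, subset_rfl, contDiffOn_id, fun t _ => ⟨t.2, rfl⟩⟩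

theorem IsGermMap.comp {p q r : PointedPlot X x} {f : Euc p.dim → Euc q.dim}
    {g : Euc q.dim → Euc r.dim} (hf : IsGermMap p q f) (hg : IsGermMap q r g) :
    IsGermMap p r (g ∘ f) := by
  obtain ⟨hf0, W, hWo, hW0, hWp, hWf, hW⟩ := hf
  obtain ⟨hg0, V, hVo, hV0, hVq, hVg, hV⟩ := hg
  refine ⟨by simp [hf0, hg0], W ∩ f ⁻¹' V, hWf.continuousOn.isOpen_inter_preimage hWo hVo,
    ⟨hW0, by simpa [hf0] using hV0⟩, fun t ht => hWp ht.1,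
    hVg.comp (hWf.mono Set.inter_subset_left) fun t ht => ht.2, fun t ht => ?_⟩
  obtain ⟨h1, h2⟩ := hW t ht.1
  obtain ⟨h3, h4⟩ := hV ⟨f t, h1⟩ ht.2
  exact ⟨h3, h4.trans h2⟩

/-- The germ category of `(X, x)`: its objects are the pointed plots and its morphisms are the
germs at `0` of morphisms of pointed plots. -/
instance : Category (GermCat X x) where
  Hom p q := Quotient (germSetoid p.plot q.plot)
  id p := Quotient.mk _ ⟨_root_.id, IsGermMap.id p.plot⟩
  comp {p q r} F G := Quotient.map₂ (sa := germSetoid p.plot q.plot)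
    (sb := germSetoid q.plot r.plot) (sc := germSetoid p.plot r.plot)
    (fun f g => ⟨g.1 ∘ f.1, f.2.comp g.2⟩) (by
      intro f f' hf g g' hg
      have hc : ContinuousAt f.1 0 := by
        obtain ⟨_, W, hWo, hW0, _, hWf, _⟩ := f.2
        exact hWf.continuousOn.continuousAt (hWo.mem_nhds hW0)
      have ht : Filter.Tendsto f.1 (𝓝 0) (𝓝 0) := by
        have := hc.tendsto
        rwa [f.2.1] at this
      change (g.1 ∘ f.1) =ᶠ[𝓝 0] (g'.1 ∘ f'.1)
      have hf' : f.1 =ᶠ[𝓝 0] f'.1 := hf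
      have hg' : g.1 =ᶠ[𝓝 0] g'.1 := hg
      exact (hg'.comp_tendsto ht).trans (hf'.fun_comp g'.1)) F G
  id_comp F := by
    induction F using Quotient.inductionOn
    rfl
  comp_id F := by
    induction F using Quotient.inductionOn
    rfl
  assoc F G H := by
    induction F using Quotient.inductionOn
    induction G using Quotient.inductionOn
    induction H using Quotient.inductionOn
    rfl

end GermCat

/-- A pointed diffeological space is filtered if its germ category is. -/
def IsFilteredAt (X : Type u) [DiffeologicalSpace X] (x : X) : Prop :=
  IsFiltered (GermCat X x)

end GermCategory

section TangentBundles

/-- A diffeology on the total space of a family of vector spaces over `X` that makes it a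
diffeological vector space over `X`: the projection, the zero section, the fiberwise addition
`V ×_X V → V` and the scalar multiplication `ℝ × V → V` are smooth. -/
structure IsDVSOver {X : Type u} [DiffeologicalSpace X] {V : X → Type v}
    [∀ x, AddCommGroup (V x)] [∀ x, Module ℝ (V x)] (d : DiffeologicalSpace (Σ x, V x)) : Prop where
  proj : DSmooth fun z : Σ x, V x => z.1
  zero : DSmooth fun x : X => (⟨x, 0⟩ : Σ x, V x)
  add : DSmooth fun z : {z : (Σ x, V x) × (Σ x, V x) // z.2.1 = z.1.1} =>
    (⟨z.1.1.1, z.1.1.2 + z.2 ▸ z.1.2.2⟩ : Σ x, V x)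
  smul : DSmooth fun z : ℝ × (Σ x, V x) => (⟨z.2.1, z.1 • z.2.2⟩ : Σ x, V x)

variable (X : Type u) [DiffeologicalSpace X]

/-- The underlying set of the internal tangent bundle: the disjoint union of the tangent spaces. -/
abbrev TangentBd : Type u := Σ x : X, TangentSp X x

variable {X}

/-- The translate `t ↦ q (c + t)` of a plot `q : V → X`, as a plot pointed at `q c`. -/
def translate {n : ℕ} {V : Set (Euc n)} (hVo : IsOpen V) (hVc : IsConnected V) (q : V → X)
    (hq : DSmooth q) (c : V) : PointedPlot X (q c) where
  dim := n
  dom := (fun t => c.1 + t) ⁻¹' V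
  isOpen_dom := hVo.preimage (by fun_prop)
  isConnected_dom := (Homeomorph.addLeft c.1).isConnected_preimage.2 hVc
  zero_mem := by simp
  toFun := fun t => q ⟨c.1 + t.1, t.2⟩
  smooth := by
    refine hq.comp (fun k p hp => ?_)
    have h : ContDiff ℝ ∞ fun s => (p s).1 := IsPlot.contDiff (X := Euc n) hp
    exact ContDiff.isPlot (X := Euc n) (contDiff_const.add h)
  map_zero := by simp

/-- The map `Tq : TV = V × ℝⁿ → TX` induced by a plot `q : V → X`. -/
def tangentMap {n : ℕ} {V : Set (Euc n)} (hVo : IsOpen V) (hVc : IsConnected V) (q : V → X)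
    (hq : DSmooth q) (z : V × Euc n) : TangentBd X :=
  ⟨q z.1, TangentSp.mk (translate hVo hVc q hq z.1) z.2⟩

variable (X)

/-- Hector's diffeology on the tangent bundle: it is generated by the maps `Tq : TV → TX`, for the
plots `q : V → X` with `V` a connected open subset of some `ℝⁿ`. -/
@[reducible]
def hectorDiffeology : DiffeologicalSpace (TangentBd X) :=
  DiffeologicalSpace.generateFrom
    {s | ∃ (n : ℕ) (V : Set (Euc n)) (hVo : IsOpen V) (hVc : IsConnected V) (q : V → X)
      (hq : DSmooth q) (k : ℕ) (c : Euc k → V × Euc n),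
      IsPlot c ∧ s = ⟨k, fun t => tangentMap hVo hVc q hq (c t)⟩}

/-- The dvs diffeology on the tangent bundle: the smallest diffeology that contains Hector's
diffeology and makes the tangent bundle a diffeological vector space over `X`. -/
@[reducible]
def dvsDiffeology : DiffeologicalSpace (TangentBd X) :=
  sInf {d | hectorDiffeology X ≤ d ∧ IsDVSOver d}

variable {X}

/-- The sub-diffeology on the fiber `T_x X` of the tangent bundle with Hector's diffeology. -/
@[reducible]
def hectorAt (x : X) : DiffeologicalSpace (TangentSp X x) :=
  inducedDiffeology (fun a => (⟨x, a⟩ : TangentBd X)) (hectorDiffeology X)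

/-- The sub-diffeology on the fiber `T_x X` of the tangent bundle with the dvs diffeology. -/
@[reducible]
def dvsAt (x : X) : DiffeologicalSpace (TangentSp X x) :=
  inducedDiffeology (fun a => (⟨x, a⟩ : TangentBd X)) (dvsDiffeology X)

end TangentBundles

/-- The inclusion of a subset with the sub-diffeology is smooth. -/
theorem dSmooth_val {X : Type u} [DiffeologicalSpace X] (P : X → Prop) :
    DSmooth (Subtype.val : {x // P x} → X) :=
  fun _ _ hp => hp

end DiffTangent

end

/-!
# The tangent sequence of a diffeological bundle

Everything is phrased with germs. A germ of plots at a point is a total function `ℝⁿ → X` that is a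
plot near that point (`PlotNear`), it has tangent vectors (`tan`), and the colimit defining
`T_x X` becomes a chain rule (`tan_comp`). If `X` is filtered at `x`, then each tangent vector is
represented by a single germ (`IsFilteredAt.exists_tan_eq`), and a vector representing `0` is
killed by a germ of morphisms (`IsFilteredAt.exists_fderiv_eq_zero`).

The bundle `π` enters only through the transport it induces along a plot `q` of the base
(`IsDiffeologicalBundle.exists_transport`): a smooth family `τ x x'` of maps from the fiber over
`q x` to the fiber over `q x'`, with `τ x x` the identity.

* Surjectivity and the subductions. Transport lifts a smooth family of tangent vectors of a plot of
  `B` to a Hector plot of `TE`, along any plot of base points in `E`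
  (`IsDiffeologicalBundle.exists_lift`). As Hector plots are locally such families or constant,
  this settles Hector's diffeology. For the dvs diffeology, the functions to `TB` that lift to dvs
  plots of `TE` along every plot of base points form a diffeology which contains Hector's and makes
  `TB` a diffeological vector space; so it contains the dvs diffeology
  (`IsDiffeologicalBundle.isLiftableAt`).
* Exactness in the middle. If `π_* (p_* a) = 0`, some morphism `f` from `π ∘ p` to a plot of `B`
  kills `a`, and transporting `p u` from `f u` to `0` gives a plot of the fiber that represents
  `p_* a` (`IsDiffeologicalBundle.exists_of_map_eq_zero`).
* Injectivity. The fiber is not assumed to be filtered, but morphisms from plots of the fiber to a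
  plot of `E` can be corrected to morphisms to a plot of the fiber, because `B` is filtered
  (`IsDiffeologicalBundle.exists_fiber_cocone`). So vectors tangent to the fiber are also
  represented by single plots, and are killed in the fiber if they are killed in `E`.
-/

noncomputable section

open scoped ContDiff Topology
open Diffeology CategoryTheory

namespace DiffTangent

universe u v w

open Filter Set Metric

/-! ### Germs of smooth maps and of plots -/

/-- A map between normed spaces is smooth near `x` if it is smooth at every point of a
neighbourhood of `x`. (`ContDiffAt ℝ ∞` would only give a neighbourhood for each finite order.) -/
def SmoothNear {V : Type*} {V' : Type*} [NormedAddCommGroup V] [NormedSpace ℝ V]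
    [NormedAddCommGroup V'] [NormedSpace ℝ V'] (f : V → V') (x : V) : Prop :=
  ∀ᶠ y in 𝓝 x, ContDiffAt ℝ ∞ f y

namespace SmoothNear

variable {V V' V'' : Type*} [NormedAddCommGroup V] [NormedSpace ℝ V]
  [NormedAddCommGroup V'] [NormedSpace ℝ V'] [NormedAddCommGroup V''] [NormedSpace ℝ V'']
  {f g : V → V'} {x : V}

theorem of_contDiff (h : ContDiff ℝ ∞ f) : SmoothNear f x :=
  Eventually.of_forall fun _ => h.contDiffAt

theorem of_contDiffOn {W : Set V} (hW : IsOpen W) (hx : x ∈ W) (h : ContDiffOn ℝ ∞ f W) :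
    SmoothNear f x := by
  filter_upwards [hW.mem_nhds hx] with y hy using h.contDiffAt (hW.mem_nhds hy)

theorem contDiffAt (h : SmoothNear f x) : ContDiffAt ℝ ∞ f x := h.self_of_nhds

theorem continuousAt (h : SmoothNear f x) : ContinuousAt f x := h.contDiffAt.continuousAt

theorem differentiableAt (h : SmoothNear f x) : DifferentiableAt ℝ f x :=
  h.contDiffAt.differentiableAt (by simp)

theorem exists_contDiffOn (h : SmoothNear f x) :
    ∃ W, IsOpen W ∧ x ∈ W ∧ ContDiffOn ℝ ∞ f W := by
  obtain ⟨W, hW, hWo, hx⟩ := _root_.eventually_nhds_iff.1 h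
  exact ⟨W, hWo, hx, fun y hy => (hW y hy).contDiffWithinAt⟩

theorem comp {f : V' → V''} {g : V → V'} (hf : SmoothNear f (g x)) (hg : SmoothNear g x) :
    SmoothNear (fun y => f (g y)) x := by
  filter_upwards [hg, hg.continuousAt.eventually hf] with y h1 h2 using h2.comp y h1

theorem comp' {f : V' → V''} {g : V → V'} {z : V'} (hf : SmoothNear f z) (hg : SmoothNear g x)
    (hz : g x = z) : SmoothNear (fun y => f (g y)) x := by
  subst hz; exact hf.comp hg

theorem prodMk {f : V → V'} {g : V → V''} (hf : SmoothNear f x) (hg : SmoothNear g x) :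
    SmoothNear (fun y => (f y, g y)) x := by
  filter_upwards [hf, hg] with y h1 h2 using h1.prodMk h2

theorem const (c : V') : SmoothNear (fun _ : V => c) x := of_contDiff contDiff_const

theorem id : SmoothNear (fun y : V => y) x := of_contDiff contDiff_id

end SmoothNear

/-- A function `p : ℝⁿ → X` is a plot near `x` if it restricts to a plot on an open neighbourhood
of `x`; a plot on an open set `W` is tested by the smooth maps from Euclidean spaces into `W`. The
values of `p` far from `x` are irrelevant, so total functions represent germs of plots. -/
def PlotNear {X : Type u} (d : DiffeologicalSpace X) {n : ℕ} (p : Euc n → X) (x : Euc n) : Prop :=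
  ∃ W, IsOpen W ∧ x ∈ W ∧ ∀ (m : ℕ) (f : Euc m → Euc n), ContDiff ℝ ∞ f → (∀ t, f t ∈ W) →
    @IsPlot X d m (fun t => p (f t))

/-- A diffeomorphism from `ℝⁿ` onto an arbitrarily small ball around a given point. -/
theorem exists_chart {n : ℕ} {x : Euc n} {W : Set (Euc n)} (hW : W ∈ 𝓝 x) :
    ∃ χ ψ : Euc n → Euc n, ContDiff ℝ ∞ χ ∧ SmoothNear ψ x ∧ χ 0 = x ∧ ψ x = 0 ∧
      (∀ t, χ t ∈ W) ∧ ∀ᶠ y in 𝓝 x, χ (ψ y) = y := by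
  obtain ⟨ε, hε, hb⟩ := Metric.mem_nhds_iff.1 hW
  have htar := OpenPartialHomeomorph.univBall_target x hε
  refine ⟨OpenPartialHomeomorph.univBall x ε, (OpenPartialHomeomorph.univBall x ε).symm,
    OpenPartialHomeomorph.contDiff_univBall,
    SmoothNear.of_contDiffOn isOpen_ball (mem_ball_self hε)
      OpenPartialHomeomorph.contDiffOn_univBall_symm,
    OpenPartialHomeomorph.univBall_apply_zero x ε,
    OpenPartialHomeomorph.univBall_symm_apply_center x ε, fun t => hb ?_, ?_⟩
  · rw [← htar]
    exact (OpenPartialHomeomorph.univBall x ε).map_source (by simp)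
  · filter_upwards [isOpen_ball.mem_nhds (mem_ball_self hε)] with y hy
    exact (OpenPartialHomeomorph.univBall x ε).right_inv (by rwa [htar])

namespace PlotNear

variable {X : Type u} {Y : Type v} {d : DiffeologicalSpace X} {d' : DiffeologicalSpace Y} {n m : ℕ}
  {p q : Euc n → X} {x : Euc n}

theorem of_isPlot (h : @IsPlot X d n p) : PlotNear d p x :=
  ⟨univ, isOpen_univ, mem_univ x, fun _ _ hf _ => @isPlot_reparam X d _ _ _ _ h hf⟩

theorem isPlot (h : ∀ x, PlotNear d p x) : @IsPlot X d n p :=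
  d.locality fun x => by
    obtain ⟨W, hW, hx, H⟩ := h x
    exact ⟨W, hW, hx, fun {m} {f} hf hf' => H m f hf' hf⟩

theorem eventually (h : PlotNear d p x) : ∀ᶠ y in 𝓝 x, PlotNear d p y := by
  obtain ⟨W, hW, hx, H⟩ := h
  filter_upwards [hW.mem_nhds hx] with y hy using ⟨W, hW, hy, H⟩

theorem congr (h : PlotNear d p x) (hq : q =ᶠ[𝓝 x] p) : PlotNear d q x := by
  obtain ⟨W, hW, hx, H⟩ := h
  obtain ⟨W', hW', hWo', hx'⟩ := _root_.eventually_nhds_iff.1 hq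
  refine ⟨W ∩ W', hW.inter hWo', ⟨hx, hx'⟩, fun m f hf hfW => ?_⟩
  have := H m f hf fun t => (hfW t).1
  rwa [show (fun t => q (f t)) = fun t => p (f t) from funext fun t => hW' _ (hfW t).2]

theorem comp {f : Euc m → Euc n} {y : Euc m} (h : PlotNear d p (f y)) (hf : SmoothNear f y) :
    PlotNear d (fun t => p (f t)) y := by
  obtain ⟨W, hW, hx, H⟩ := h
  obtain ⟨W', hWo', hy, hW'⟩ := hf.exists_contDiffOn
  refine ⟨W' ∩ f ⁻¹' W, hW'.continuousOn.isOpen_inter_preimage hWo' hW, ⟨hy, hx⟩,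
    fun k g hg hgW => H k (fun t => f (g t)) ?_ fun t => (hgW t).2⟩
  exact hW'.comp_contDiff hg fun t => (hgW t).1

theorem comp' {f : Euc m → Euc n} {y : Euc m} (h : PlotNear d p x) (hf : SmoothNear f y)
    (hx : f y = x) : PlotNear d (fun t => p (f t)) y := by
  subst hx; exact h.comp hf

theorem map {f : X → Y} (hf : ∀ n (p : Euc n → X), @IsPlot X d n p → @IsPlot Y d' n (f ∘ p))
    (h : PlotNear d p x) : PlotNear d' (fun t => f (p t)) x := by
  obtain ⟨W, hW, hx, H⟩ := h
  exact ⟨W, hW, hx, fun m g hg hgW => hf m _ (H m g hg hgW)⟩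

theorem const (a : X) : PlotNear d (fun _ : Euc n => a) x :=
  of_isPlot (@isPlot_const X d n a)

theorem of_comp_chart {χ ψ : Euc n → Euc n} (hψ : SmoothNear ψ x)
    (hχψ : ∀ᶠ y in 𝓝 x, χ (ψ y) = y) (h : PlotNear d (fun t => p (χ t)) (ψ x)) :
    PlotNear d p x :=
  (h.comp hψ).congr (hχψ.mono fun y hy => by simp only [hy])

end PlotNear

theorem PlotNear.of_dSmooth {X : Type u} [d : DiffeologicalSpace X] {n : ℕ} {W : Set (Euc n)}
    (hW : IsOpen W) {q : W → X} (hq : DSmooth q) {p : Euc n → X} (hp : ∀ t : W, p t = q t)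
    {x : Euc n} (hx : x ∈ W) : PlotNear d p x := by
  refine ⟨W, hW, hx, fun m f hf hfW => ?_⟩
  have h := hq m (fun t => ⟨f t, hfW t⟩) (ContDiff.isPlot (X := Euc n) hf)
  rwa [show (fun t => p (f t)) = q ∘ fun t => ⟨f t, hfW t⟩ from
    funext fun t => hp ⟨f t, hfW t⟩]

theorem PlotNear.exists_dSmooth {X : Type u} [d : DiffeologicalSpace X] {n : ℕ} {p : Euc n → X}
    {x : Euc n} (h : PlotNear d p x) {U : Set (Euc n)} (hU : U ∈ 𝓝 x) :
    ∃ ε > 0, ball x ε ⊆ U ∧ DSmooth (fun t : ball x ε => p t) := by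
  obtain ⟨W, hW, hx, H⟩ := h
  obtain ⟨ε, hε, hb⟩ := Metric.mem_nhds_iff.1 (inter_mem (hW.mem_nhds hx) hU)
  refine ⟨ε, hε, fun t ht => (hb ht).2, fun m f hf => ?_⟩
  exact H m (fun t => (f t).1) (IsPlot.contDiff (X := Euc n) hf) fun t => (hb (f t).2).1

/-- The diffeology whose plots are the functions all of whose germs have a given property. -/
@[reducible]
def germDiffeology {X : Type u} (Q : ∀ {n : ℕ}, (Euc n → X) → Euc n → Prop)
    (congr : ∀ {n : ℕ} {p q : Euc n → X} {x : Euc n}, Q p x → q =ᶠ[𝓝 x] p → Q q x)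
    (const : ∀ {n : ℕ} (a : X) (x : Euc n), Q (fun _ => a) x)
    (reparam : ∀ {n m : ℕ} {p : Euc n → X} {f : Euc m → Euc n} {x : Euc m},
      Q p (f x) → SmoothNear f x → Q (fun t => p (f t)) x) : DiffeologicalSpace X where
  plots _ := {p | ∀ x, Q p x}
  constant_plots a := const a
  plot_reparam {_ _ _ f} hp hf x := reparam (f := f) (hp (f x)) (SmoothNear.of_contDiff hf)
  locality {n p} hp x := by
    obtain ⟨W, hW, hx, H⟩ := hp x
    obtain ⟨χ, ψ, h1, h2, -, -, h5, h6⟩ := exists_chart (hW.mem_nhds hx)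
    exact congr (reparam (H h5 h1 (ψ x)) h2) (h6.mono fun y hy => by simp [hy])

/-- Near each point, a plot of a generated diffeology is constant or factors smoothly through a
generator. -/
theorem isPlot_generateFrom {X : Type u} {G : Set ((n : ℕ) × (Euc n → X))} {n : ℕ}
    {p : Euc n → X} (hp : @IsPlot X (DiffeologicalSpace.generateFrom G) n p) (x : Euc n) :
    (∃ a, p =ᶠ[𝓝 x] fun _ => a) ∨ ∃ (k : ℕ) (g : Euc k → X) (f : Euc n → Euc k),
      (⟨k, g⟩ : (n : ℕ) × (Euc n → X)) ∈ G ∧ SmoothNear f x ∧ p =ᶠ[𝓝 x] fun t => g (f t) := by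
  let D : DiffeologicalSpace X := germDiffeology
    (fun {n} p x => (∃ a, p =ᶠ[𝓝 x] fun _ => a) ∨ ∃ (k : ℕ) (g : Euc k → X) (f : Euc n → Euc k),
      (⟨k, g⟩ : (n : ℕ) × (Euc n → X)) ∈ G ∧ SmoothNear f x ∧ p =ᶠ[𝓝 x] fun t => g (f t))
    (fun h hq => h.imp (fun ⟨a, ha⟩ => ⟨a, hq.trans ha⟩)
      fun ⟨k, g, f, h1, h2, h3⟩ => ⟨k, g, f, h1, h2, hq.trans h3⟩)
    (fun a _ => Or.inl ⟨a, EventuallyEq.rfl⟩)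
    (fun h hf => h.imp (fun ⟨a, ha⟩ => ⟨a, hf.continuousAt.eventually ha⟩)
      fun ⟨k, g, f, h1, h2, h3⟩ =>
        ⟨k, g, fun t => f _, h1, h2.comp hf, hf.continuousAt.eventually h3⟩)
  have hle : DiffeologicalSpace.generateFrom G ≤ D := by
    refine DiffeologicalSpace.generateFrom_le_iff.2 fun k g hg y => Or.inr ?_
    exact ⟨k, g, fun t => t, hg, SmoothNear.id, EventuallyEq.rfl⟩
  exact DiffeologicalSpace.le_iff'.1 hle n p hp x

/-! ### Tangent vectors represented by germs of plots -/

section GermVectors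

variable {X : Type u} [d : DiffeologicalSpace X] {x : X} {Y : Type v} [d' : DiffeologicalSpace Y]
  {y : Y}

/-- The colimit defining the tangent space does not distinguish morphisms from germs of
morphisms, since the restriction of a plot to a ball is isomorphic to it in the colimit. -/
theorem mk_eq_of_isGermMap {P Q : PointedPlot X x} {f : Euc P.dim → Euc Q.dim}
    (hf : GermCat.IsGermMap P Q f) (a : Euc P.dim) :
    TangentSp.mk P a = TangentSp.mk Q (fderiv ℝ f 0 a) := by
  obtain ⟨hf0, W, hWo, hW0, hWP, hfW, H⟩ := hf
  obtain ⟨ε, hε, hb⟩ := Metric.mem_nhds_iff.1 (hWo.mem_nhds hW0)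
  let R : PointedPlot X x :=
    { dim := P.dim
      dom := ball 0 ε
      isOpen_dom := isOpen_ball
      isConnected_dom := (convex_ball 0 ε).isConnected ⟨0, mem_ball_self hε⟩
      zero_mem := mem_ball_self hε
      toFun := fun t => P.toFun ⟨t.1, hWP (hb t.2)⟩
      smooth := fun m g hg => P.smooth m (fun t => ⟨(g t).1, hWP (hb (g t).2)⟩) hg
      map_zero := P.map_zero }
  have h1 : R.IsMorphism P (fun t => t) := ⟨contDiffOn_id, rfl, fun t => ⟨hWP (hb t.2), rfl⟩⟩
  have h2 : R.IsMorphism Q f :=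
    ⟨hfW.mono hb, hf0, fun t => H ⟨t.1, hWP (hb t.2)⟩ (hb t.2)⟩
  have h3 := TangentSp.mk_eq h1 a
  rw [fderiv_fun_id] at h3
  exact h3.symm.trans (TangentSp.mk_eq h2 a)

/-- Tangent vectors represented by a single pointed plot span the tangent space. -/
theorem TangentSp.induction {motive : TangentSp X x → Prop} (zero : motive 0)
    (mk : ∀ P a, motive (TangentSp.mk P a))
    (add : ∀ v w, motive v → motive w → motive (v + w)) (v : TangentSp X x) : motive v := by
  classical
  obtain ⟨ξ, rfl⟩ := (tangentRelations X x).mkQ_surjective v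
  induction ξ using DirectSum.induction_on with
  | zero => rw [map_zero]; exact zero
  | of P a =>
    exact mk P a
  | add ξ η h1 h2 => rw [map_add]; exact add _ _ h1 h2

theorem PlotNear.exists_dSmooth_add {n : ℕ} {p : Euc n → X} {c : Euc n} (h : PlotNear d p c) :
    ∃ ε > 0, DSmooth (fun t : ball (0 : Euc n) ε => p (c + t)) := by
  have h1 : PlotNear d (fun t => p (c + t)) 0 :=
    h.comp' (SmoothNear.of_contDiff (contDiff_const.add contDiff_id)) (by simp)
  obtain ⟨ε, hε, -, h2⟩ := h1.exists_dSmooth univ_mem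
  exact ⟨ε, hε, h2⟩

/-- The pointed plot `t ↦ p (c + t)` on a small ball, for a germ `p` of plots at `c`. -/
@[reducible]
def PlotNear.pointedPlot {n : ℕ} {p : Euc n → X} {c : Euc n} (h : PlotNear d p c)
    (hc : p c = x) : PointedPlot X x where
  dim := n
  dom := ball 0 h.exists_dSmooth_add.choose
  isOpen_dom := isOpen_ball
  isConnected_dom := (convex_ball 0 _).isConnected
    ⟨0, mem_ball_self h.exists_dSmooth_add.choose_spec.1⟩
  zero_mem := mem_ball_self h.exists_dSmooth_add.choose_spec.1
  toFun := fun t => p (c + t)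
  smooth := h.exists_dSmooth_add.choose_spec.2
  map_zero := by simpa using hc

open Classical in
/-- The tangent vector `p_* v ∈ T_x X` of a germ `p : (ℝⁿ, c) → (X, x)` of plots. The base point
`x` is a separate argument, so that germs that agree only up to a proof give vectors in the same
space; the value is `0` when `p` is not a plot near `c` or `p c ≠ x`. -/
def tan {n : ℕ} (p : Euc n → X) (c : Euc n) (x : X) : Euc n →ₗ[ℝ] TangentSp X x :=
  if h : PlotNear d p c ∧ p c = x then TangentSp.mk (h.1.pointedPlot h.2) else 0

theorem tan_eq {n : ℕ} {p : Euc n → X} {c : Euc n} (h : PlotNear d p c) (hc : p c = x)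
    (v : Euc n) : tan p c x v = TangentSp.mk (h.pointedPlot hc) v := by
  rw [tan, dif_pos ⟨h, hc⟩]

theorem isGermMap_translate {P Q : PointedPlot X x} {p : Euc P.dim → X} {q : Euc Q.dim → X}
    {c : Euc P.dim} {c' : Euc Q.dim} (hP : ∀ t : P.dom, P.toFun t = p (c + t))
    (hQ : ∀ t : Q.dom, Q.toFun t = q (c' + t)) {f : Euc P.dim → Euc Q.dim} (hf : SmoothNear f c)
    (hfc : f c = c') (hpq : p =ᶠ[𝓝 c] fun t => q (f t)) :
    GermCat.IsGermMap P Q (fun t => f (c + t) - c') := by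
  have htr : Tendsto (fun t => c + t) (𝓝 (0 : Euc P.dim)) (𝓝 c) := by
    have : Continuous fun t : Euc P.dim => c + t := by fun_prop
    simpa using this.tendsto 0
  have hg : SmoothNear (fun t => f (c + t) - c') 0 := by
    have h1 : SmoothNear (fun t : Euc P.dim => c + t) 0 :=
      SmoothNear.of_contDiff (contDiff_const.add contDiff_id)
    have h2 : SmoothNear (fun s => s - c') (f c) :=
      SmoothNear.of_contDiff (contDiff_id.sub contDiff_const)
    exact h2.comp' (hf.comp' h1 (by simp)) (by simp)
  refine ⟨by simp [hfc], ?_⟩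
  obtain ⟨W, hWo, hW0, hW⟩ := hg.exists_contDiffOn
  have hQn : ∀ᶠ t in 𝓝 (0 : Euc P.dim), f (c + t) - c' ∈ Q.dom := by
    refine hg.continuousAt.eventually (Q.isOpen_dom.mem_nhds ?_)
    simpa [hfc] using Q.zero_mem
  obtain ⟨W', hW', hWo', hW0'⟩ := _root_.eventually_nhds_iff.1 (hQn.and (htr.eventually hpq))
  refine ⟨W ∩ W' ∩ P.dom, (hWo.inter hWo').inter P.isOpen_dom, ⟨⟨hW0, hW0'⟩, P.zero_mem⟩,
    fun t ht => ht.2, hW.mono fun t ht => ht.1.1, fun t ht => ?_⟩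
  obtain ⟨h1, h2⟩ := hW' t ht.1.2
  refine ⟨h1, ?_⟩
  rw [hQ, hP, h2]
  simp

theorem mk_eq_tan {P : PointedPlot X x} {p : Euc P.dim → X} {c : Euc P.dim}
    (hP : ∀ t : P.dom, P.toFun t = p (c + t)) (v : Euc P.dim) :
    TangentSp.mk P v = tan p c x v := by
  have h1 : PlotNear d (fun t => p (c + t)) 0 :=
    PlotNear.of_dSmooth P.isOpen_dom P.smooth (fun t => (hP t).symm) P.zero_mem
  have h2 : PlotNear d p c := by
    have h3 : SmoothNear (fun t => t - c) c :=
      SmoothNear.of_contDiff (contDiff_id.sub contDiff_const)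
    exact (h1.comp' h3 (by simp)).congr (Eventually.of_forall fun t => by simp)
  have h3 : p c = x := by
    rw [← P.map_zero, hP]; simp
  rw [tan_eq h2 h3]
  have h4 := mk_eq_of_isGermMap (isGermMap_translate (P := P) (Q := h2.pointedPlot h3)
    (q := p) (c' := c) hP (fun t => rfl) (f := fun t => t) SmoothNear.id rfl EventuallyEq.rfl) v
  rw [h4]
  congr 1
  have : (fun t : Euc P.dim => c + t - c) = fun t => t := by funext t; simp
  rw [this, fderiv_fun_id]
  rfl

/-- The chain rule for tangent vectors of germs of plots. -/
theorem tan_comp {n m : ℕ} {p : Euc n → X} {q : Euc m → X} {f : Euc n → Euc m} {c : Euc n}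
    {c' : Euc m} (hq : PlotNear d q c') (hf : SmoothNear f c) (hfc : f c = c') (hx : q c' = x)
    (hpq : p =ᶠ[𝓝 c] fun t => q (f t)) (v : Euc n) :
    tan p c x v = tan q c' x (fderiv ℝ f c v) := by
  have hp : PlotNear d p c := (hq.comp' hf hfc).congr hpq
  have hpx : p c = x := by rw [hpq.self_of_nhds]; exact (congrArg q hfc).trans hx
  rw [tan_eq hp hpx, tan_eq hq hx]
  have h4 := mk_eq_of_isGermMap (isGermMap_translate (P := hp.pointedPlot hpx)
    (Q := hq.pointedPlot hx) (p := p) (q := q) (c := c) (c' := c') (fun t => rfl) (fun t => rfl)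
    (f := f) hf hfc hpq) v
  rw [h4]
  congr 1
  have h5 : HasFDerivAt (fun t => f (c + t) - c') (fderiv ℝ f c) 0 := by
    have h6 : HasFDerivAt f (fderiv ℝ f c) (c + 0) := by
      rw [add_zero]; exact hf.differentiableAt.hasFDerivAt
    have h7 : HasFDerivAt (fun t : Euc n => c + t) (ContinuousLinearMap.id ℝ (Euc n)) 0 :=
      (hasFDerivAt_id _).const_add c
    simpa using (h6.comp (0 : Euc n) h7).sub_const c'
  exact congrArg (fun L : Euc n →L[ℝ] Euc m => L v) h5.fderiv

theorem tan_congr {n : ℕ} {p q : Euc n → X} {c : Euc n} (hq : PlotNear d q c) (hx : q c = x)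
    (hpq : p =ᶠ[𝓝 c] q) (v : Euc n) : tan p c x v = tan q c x v := by
  have := tan_comp hq (f := fun t => t) SmoothNear.id rfl hx hpq v
  rwa [fderiv_fun_id] at this

theorem tan_const {n : ℕ} (c : Euc n) (x : X) (v : Euc n) : tan (fun _ => x) c x v = 0 := by
  rw [tan_comp (q := fun _ : Euc 0 => x) (f := fun _ => 0) (c' := 0) (PlotNear.const x)
    (SmoothNear.const _) rfl rfl EventuallyEq.rfl, Subsingleton.elim (fderiv ℝ _ _ _) 0, map_zero]

theorem map_tan {f : X → Y} (hf : DSmooth f) (hxy : f x = y) {n : ℕ} {p : Euc n → X} {c : Euc n}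
    (hp : PlotNear d p c) (hx : p c = x) (v : Euc n) :
    TangentSp.map f hf hxy (tan p c x v) = tan (fun t => f (p t)) c y v := by
  rw [tan_eq hp hx, TangentSp.map_mk]
  exact mk_eq_tan (P := (hp.pointedPlot hx).push f hf hxy) (fun t => rfl) v

/-- Every pointed plot is represented by a total function. -/
theorem PointedPlot.exists_extension (P : PointedPlot X x) :
    ∃ p : Euc P.dim → X, PlotNear d p 0 ∧ p 0 = x ∧ ∀ t : P.dom, P.toFun t = p t := by
  classical
  let p : Euc P.dim → X := fun t => if h : t ∈ P.dom then P.toFun ⟨t, h⟩ else x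
  have hp : ∀ t : P.dom, p t = P.toFun t := fun t => by simp [p]
  exact ⟨p, PlotNear.of_dSmooth P.isOpen_dom P.smooth hp P.zero_mem,
    (hp ⟨0, P.zero_mem⟩).trans P.map_zero, fun t => (hp t).symm⟩

end GermVectors

/-! ### Filtered germ categories -/

section Filtered

variable {X : Type u} [d : DiffeologicalSpace X] {x : X}

/-- `f` is a germ at `0` of a morphism of pointed plots from `p` to `q`. -/
structure IsGermHom {n m : ℕ} (p : Euc n → X) (q : Euc m → X) (f : Euc n → Euc m) : Prop where
  smooth : SmoothNear f 0
  map_zero : f 0 = 0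
  comm : p =ᶠ[𝓝 0] fun t => q (f t)

theorem GermCat.IsGermMap.isGermHom {P Q : PointedPlot X x} {f : Euc P.dim → Euc Q.dim}
    (h : GermCat.IsGermMap P Q f) {p : Euc P.dim → X} {q : Euc Q.dim → X}
    (hp : ∀ t : P.dom, P.toFun t = p t) (hq : ∀ t : Q.dom, Q.toFun t = q t) :
    IsGermHom p q f := by
  obtain ⟨hf0, W, hWo, hW0, hWP, hfW, H⟩ := h
  refine ⟨SmoothNear.of_contDiffOn hWo hW0 hfW, hf0, ?_⟩
  filter_upwards [hWo.mem_nhds hW0] with t ht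
  obtain ⟨h1, h2⟩ := H ⟨t, hWP ht⟩ ht
  rw [hp, hq] at h2
  exact h2.symm

theorem IsGermHom.isGermMap {P Q : PointedPlot X x} {f : Euc P.dim → Euc Q.dim}
    {p : Euc P.dim → X} {q : Euc Q.dim → X} (h : IsGermHom p q f)
    (hp : ∀ t : P.dom, P.toFun t = p t) (hq : ∀ t : Q.dom, Q.toFun t = q t) :
    GermCat.IsGermMap P Q f := by
  simpa using isGermMap_translate (c := 0) (c' := 0) (by simpa using hp) (by simpa using hq)
    h.smooth h.map_zero h.comm

/-- The object of the germ category given by a germ of plots at `0`. -/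
abbrev PlotNear.germObj {n : ℕ} {p : Euc n → X} (h : PlotNear d p 0) (h0 : p 0 = x) :
    GermCat X x :=
  ⟨h.pointedPlot h0⟩

theorem IsFilteredAt.exists_cocone (hX : IsFilteredAt X x) {n m : ℕ} {p : Euc n → X}
    {q : Euc m → X} (hp : PlotNear d p 0) (hp0 : p 0 = x) (hq : PlotNear d q 0) (hq0 : q 0 = x) :
    ∃ (k : ℕ) (r : Euc k → X) (f : Euc n → Euc k) (g : Euc m → Euc k),
      PlotNear d r 0 ∧ r 0 = x ∧ IsGermHom p r f ∧ IsGermHom q r g := by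
  obtain ⟨R, F, G, -⟩ := hX.cocone_objs (hp.germObj hp0) (hq.germObj hq0)
  obtain ⟨⟨f, hf⟩, -⟩ := Quotient.exists_rep F
  obtain ⟨⟨g, hg⟩, -⟩ := Quotient.exists_rep G
  obtain ⟨r, hr, hr0, hRr⟩ := R.plot.exists_extension
  exact ⟨R.plot.dim, r, f, g, hr, hr0, hf.isGermHom (fun t => by simp) hRr,
    hg.isGermHom (fun t => by simp) hRr⟩

theorem IsFilteredAt.exists_coequalizer (hX : IsFilteredAt X x) {n m : ℕ} {p : Euc n → X}
    {q : Euc m → X} (hp : PlotNear d p 0) (hp0 : p 0 = x) (hq : PlotNear d q 0) (hq0 : q 0 = x)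
    {f g : Euc n → Euc m} (hf : IsGermHom p q f) (hg : IsGermHom p q g) :
    ∃ (k : ℕ) (r : Euc k → X) (h : Euc m → Euc k),
      PlotNear d r 0 ∧ r 0 = x ∧ IsGermHom q r h ∧
        (fun t => h (f t)) =ᶠ[𝓝 0] fun t => h (g t) := by
  let F : hp.germObj hp0 ⟶ hq.germObj hq0 := Quotient.mk (GermCat.germSetoid _ _)
    ⟨f, hf.isGermMap (fun t => by simp) (fun t => by simp)⟩
  let G : hp.germObj hp0 ⟶ hq.germObj hq0 := Quotient.mk (GermCat.germSetoid _ _)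
    ⟨g, hg.isGermMap (fun t => by simp) (fun t => by simp)⟩
  obtain ⟨R, K, hK⟩ := hX.cocone_maps F G
  obtain ⟨⟨h, hh⟩, rfl⟩ := Quotient.exists_rep K
  obtain ⟨r, hr, hr0, hRr⟩ := R.plot.exists_extension
  exact ⟨R.plot.dim, r, h, hr, hr0, hh.isGermHom (fun t => by simp) hRr, Quotient.exact hK⟩

theorem IsGermHom.tan_eq {n m : ℕ} {p : Euc n → X} {q : Euc m → X} {f : Euc n → Euc m}
    (h : IsGermHom p q f) (hq : PlotNear d q 0) (hq0 : q 0 = x) (v : Euc n) :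
    tan p 0 x v = tan q 0 x (fderiv ℝ f 0 v) :=
  tan_comp hq h.smooth h.map_zero hq0 h.comm v

/-- In a filtered colimit every element is represented at a single object. -/
theorem IsFilteredAt.exists_tan_eq (hX : IsFilteredAt X x) (v : TangentSp X x) :
    ∃ (n : ℕ) (p : Euc n → X) (a : Euc n), PlotNear d p 0 ∧ p 0 = x ∧ tan p 0 x a = v := by
  induction v using TangentSp.induction with
  | zero => exact ⟨0, fun _ => x, 0, PlotNear.const x, rfl, map_zero _⟩
  | mk P a =>
    obtain ⟨p, hp, hp0, hPp⟩ := P.exists_extension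
    exact ⟨P.dim, p, a, hp, hp0, (mk_eq_tan (fun t => by rw [zero_add, hPp]) a).symm⟩
  | add v w hv hw =>
    obtain ⟨n, p, a, hp, hp0, rfl⟩ := hv
    obtain ⟨m, q, c, hq, hq0, rfl⟩ := hw
    obtain ⟨k, r, f, g, hr, hr0, hf, hg⟩ := hX.exists_cocone hp hp0 hq hq0
    refine ⟨k, r, fderiv ℝ f 0 a + fderiv ℝ g 0 c, hr, hr0, ?_⟩
    rw [map_add, ← hf.tan_eq hr hr0, ← hg.tan_eq hr hr0]

/-- The derivative at `0` of a germ. -/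
def germDeriv {P Q : GermCat X x} (φ : P ⟶ Q) : Euc P.plot.dim →L[ℝ] Euc Q.plot.dim :=
  Quotient.lift (s := GermCat.germSetoid P.plot Q.plot) (fun f => fderiv ℝ f.1 0)
    (fun _ _ h => Filter.EventuallyEq.fderiv_eq h) φ

theorem germDeriv_comp {P Q R : GermCat X x} (φ : P ⟶ Q) (ψ : Q ⟶ R) :
    germDeriv (φ ≫ ψ) = (germDeriv ψ).comp (germDeriv φ) := by
  obtain ⟨⟨f, hf⟩, rfl⟩ := Quotient.exists_rep φ
  obtain ⟨⟨g, hg⟩, rfl⟩ := Quotient.exists_rep ψ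
  obtain ⟨p, -, -, hp⟩ := P.plot.exists_extension
  obtain ⟨q, -, -, hq⟩ := Q.plot.exists_extension
  obtain ⟨r, -, -, hr⟩ := R.plot.exists_extension
  have h1 := hf.isGermHom hp hq
  have h2 := hg.isGermHom hq hr
  change fderiv ℝ (g ∘ f) 0 = (fderiv ℝ g 0).comp (fderiv ℝ f 0)
  have h3 : DifferentiableAt ℝ g (f 0) := by
    rw [h1.map_zero]; exact h2.smooth.differentiableAt
  rw [fderiv_comp _ h3 h1.smooth.differentiableAt, h1.map_zero]

open Classical in
/-- A formal combination `ξ` of vectors at pointed plots vanishes eventually if there is a finite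
diagram of plots such that every cocone on it sends `ξ` to zero. -/
def EventuallyZero (ξ : DirectSum (PointedPlot X x) fun p => Euc p.dim) : Prop :=
  ∃ (O : Finset (GermCat X x)) (H : Finset (Σ Z Z' : GermCat X x, Z ⟶ Z')),
    ∀ (S : GermCat X x) (T : ∀ {Z : GermCat X x}, Z ∈ O → (Z ⟶ S)),
      (∀ {Z Z' : GermCat X x} (hZ : Z ∈ O) (hZ' : Z' ∈ O) {f : Z ⟶ Z'},
        (⟨Z, Z', f⟩ : Σ Z Z' : GermCat X x, Z ⟶ Z') ∈ H → f ≫ T hZ' = T hZ) →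
      ∀ L : ∀ P : PointedPlot X x, Euc P.dim →ₗ[ℝ] Euc S.plot.dim,
        (∀ (P : PointedPlot X x) (h : (⟨P⟩ : GermCat X x) ∈ O) (a : Euc P.dim),
          L P a = germDeriv (T h) a) →
        DirectSum.toModule ℝ (PointedPlot X x) (Euc S.plot.dim) L ξ = 0

open Classical in
theorem eventuallyZero_of_mem {ξ : DirectSum (PointedPlot X x) fun p => Euc p.dim}
    (hξ : ξ ∈ tangentRelations X x) : EventuallyZero ξ := by
  induction hξ using Submodule.span_induction with
  | mem ξ h =>
    obtain ⟨P, Q, f, a, hf, rfl⟩ := h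
    let φ : (⟨P⟩ : GermCat X x) ⟶ ⟨Q⟩ := Quotient.mk (GermCat.germSetoid P Q)
      ⟨f, hf.map_zero, P.dom, P.isOpen_dom, P.zero_mem, subset_rfl, hf.contDiffOn,
        fun t _ => hf.comm t⟩
    refine ⟨{⟨P⟩, ⟨Q⟩}, {⟨_, _, φ⟩}, fun S T hT L hL => ?_⟩
    have hP : (⟨P⟩ : GermCat X x) ∈ ({⟨P⟩, ⟨Q⟩} : Finset (GermCat X x)) := by simp
    have hQ : (⟨Q⟩ : GermCat X x) ∈ ({⟨P⟩, ⟨Q⟩} : Finset (GermCat X x)) := by simp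
    have h1 : φ ≫ T hQ = T hP := hT hP hQ (Finset.mem_singleton_self _)
    have h2 := DirectSum.toModule_lof ℝ (φ := L) P a
    have h3 := DirectSum.toModule_lof ℝ (φ := L) Q (fderiv ℝ f 0 a)
    rw [map_sub, sub_eq_zero]
    refine h2.trans (Eq.trans ?_ h3.symm)
    rw [hL P hP, hL Q hQ, ← h1, germDeriv_comp]
    rfl
  | zero => exact ⟨∅, ∅, fun S T _ L _ => map_zero _⟩
  | add ξ η _ _ h1 h2 =>
    obtain ⟨O, H, h1⟩ := h1
    obtain ⟨O', H', h2⟩ := h2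
    refine ⟨O ∪ O', H ∪ H', fun S T hT L hL => ?_⟩
    rw [map_add, h1 S (fun hZ => T (Finset.mem_union_left _ hZ))
      (fun {_ _} _ _ {_} hf => hT _ _ (Finset.mem_union_left _ hf)) L fun P h a => hL P _ a,
      h2 S (fun hZ => T (Finset.mem_union_right _ hZ))
      (fun {_ _} _ _ {_} hf => hT _ _ (Finset.mem_union_right _ hf)) L fun P h a => hL P _ a,
      add_zero]
  | smul c ξ _ h =>
    obtain ⟨O, H, h⟩ := h
    refine ⟨O, H, fun S T hT L hL => ?_⟩
    rw [map_smul, h S T hT L hL, smul_zero]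

/-- In a filtered colimit, a vector that represents zero is sent to zero by some morphism. -/
theorem IsFilteredAt.exists_fderiv_eq_zero (hX : IsFilteredAt X x) {n : ℕ} {p : Euc n → X}
    (hp : PlotNear d p 0) (hp0 : p 0 = x) {a : Euc n} (ha : tan p 0 x a = 0) :
    ∃ (k : ℕ) (r : Euc k → X) (f : Euc n → Euc k),
      PlotNear d r 0 ∧ r 0 = x ∧ IsGermHom p r f ∧ fderiv ℝ f 0 a = 0 := by
  classical
  rw [tan_eq hp hp0] at ha
  obtain ⟨O, H, h⟩ := eventuallyZero_of_mem
    ((Submodule.Quotient.mk_eq_zero (tangentRelations X x)).1 ha)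
  -- A cocone on the diagram, enlarged by the given plot, kills the vector.
  let P : GermCat X x := hp.germObj hp0
  have hP : P ∈ insert P O := Finset.mem_insert_self _ _
  have : IsFiltered (GermCat X x) := hX
  let H' : Finset (Σ' (Z Z' : GermCat X x) (_ : Z ∈ insert P O) (_ : Z' ∈ insert P O), Z ⟶ Z') :=
    H.preimage (fun z => ⟨z.1, z.2.1, z.2.2.2.2⟩) (by
      rintro ⟨Z, Z', h1, h2, f⟩ _ ⟨W, W', h3, h4, g⟩ _ h
      cases h
      rfl)
  obtain ⟨S, T, hT⟩ := IsFiltered.sup_exists (insert P O) H'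
  let L : ∀ P : PointedPlot X x, Euc P.dim →ₗ[ℝ] Euc S.plot.dim := fun Q =>
    if h : (⟨Q⟩ : GermCat X x) ∈ insert P O then (germDeriv (T h)).toLinearMap else 0
  have hL : ∀ (Q : PointedPlot X x) (h : (⟨Q⟩ : GermCat X x) ∈ insert P O) (v : Euc Q.dim),
      L Q v = germDeriv (T h) v := fun Q h v => by simp only [L, dif_pos h]; rfl
  have h0 := h S (fun hZ => T (Finset.mem_insert_of_mem hZ))
    (fun {_ _} _ _ {_} hf => hT _ _ (Finset.mem_preimage.2 hf)) L fun Q h v => hL Q _ v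
  have h1 := DirectSum.toModule_lof ℝ (φ := L) P.plot a
  have h2 : germDeriv (T hP) a = 0 := by
    rw [← hL P.plot hP a, ← h1]
    convert h0
  obtain ⟨⟨f, hf⟩, hfT⟩ := Quotient.exists_rep (T hP)
  obtain ⟨r, hr, hr0, hSr⟩ := S.plot.exists_extension
  rw [← hfT] at h2
  exact ⟨S.plot.dim, r, f, hr, hr0, hf.isGermHom (fun t => by simp [P]) hSr, h2⟩

end Filtered

/-! ### Plots of Hector's diffeology -/

section Hector

variable {X : Type u} [d : DiffeologicalSpace X] {Y : Type v} [d' : DiffeologicalSpace Y]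

theorem tangentMap_eq {n : ℕ} {V : Set (Euc n)} (hVo : IsOpen V) (hVc : IsConnected V) {q : V → X}
    (hq : DSmooth q) {q' : Euc n → X} (hq' : ∀ t : V, q' t = q t) (z : V × Euc n) {x : X}
    (hx : q' z.1 = x) : tangentMap hVo hVc q hq z = ⟨x, tan q' z.1 x z.2⟩ := by
  subst hx
  rw [hq']
  exact congrArg (Sigma.mk (q z.1)) (mk_eq_tan (P := translate hVo hVc q hq z.1)
    (fun t : ((fun t => z.1.1 + t) ⁻¹' V : Set (Euc n)) => (hq' ⟨z.1.1 + t.1, t.2⟩).symm) z.2)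

/-- A smooth family of tangent vectors of a single plot is a plot of Hector's diffeology. -/
theorem plotNear_hector {k m : ℕ} {q : Euc k → X} {c v : Euc m → Euc k} {y : Euc m → X}
    {t₀ : Euc m} (hq : PlotNear d q (c t₀)) (hc : SmoothNear c t₀) (hv : SmoothNear v t₀)
    (hy : ∀ᶠ t in 𝓝 t₀, q (c t) = y t) :
    PlotNear (hectorDiffeology X) (fun t => (⟨y t, tan q (c t) (y t) (v t)⟩ : TangentBd X)) t₀ := by
  obtain ⟨ε, hε, -, hqε⟩ := hq.exists_dSmooth univ_mem
  have hev : ∀ᶠ t in 𝓝 t₀, c t ∈ ball (c t₀) ε ∧ ContDiffAt ℝ ∞ c t ∧ ContDiffAt ℝ ∞ v t ∧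
      q (c t) = y t :=
    (hc.continuousAt.eventually (ball_mem_nhds _ hε)).and (hc.and (hv.and hy))
  obtain ⟨χ, ψ, hχ, hψ, -, -, hχU, hχψ⟩ := exists_chart hev
  refine PlotNear.of_comp_chart hψ hχψ (PlotNear.of_isPlot ?_)
  refine DiffeologicalSpace.isPlot_generatedFrom_of_mem ?_
  refine ⟨k, ball (c t₀) ε, isOpen_ball, (convex_ball _ _).isConnected ⟨_, mem_ball_self hε⟩,
    fun t => q t, hqε, m, fun t => (⟨c (χ t), (hχU t).1⟩, v (χ t)), ⟨?_, ?_⟩, ?_⟩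
  · exact ContDiff.isPlot (X := Euc k) <| contDiff_iff_contDiffAt.2 fun t =>
      (hχU t).2.1.comp t hχ.contDiffAt
  · exact ContDiff.isPlot (X := Euc k) <| contDiff_iff_contDiffAt.2 fun t =>
      (hχU t).2.2.1.comp t hχ.contDiffAt
  · congr 1
    funext t
    exact (tangentMap_eq _ _ hqε (fun _ => rfl) (⟨c (χ t), (hχU t).1⟩, v (χ t))
      (hχU t).2.2.2).symm

theorem isPlot_hector {n : ℕ} {p : Euc n → TangentBd X}
    (hp : @IsPlot _ (hectorDiffeology X) n p) (x : Euc n) :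
    (∃ a, p =ᶠ[𝓝 x] fun _ => a) ∨ ∃ (k : ℕ) (q : Euc k → X) (c v : Euc n → Euc k),
      PlotNear d q (c x) ∧ SmoothNear c x ∧ SmoothNear v x ∧
        p =ᶠ[𝓝 x] fun t => ⟨q (c t), tan q (c t) (q (c t)) (v t)⟩ := by
  classical
  refine (isPlot_generateFrom hp x).imp id ?_
  rintro ⟨l, g, f, ⟨k, V, hVo, hVc, q, hq, l', c, hc, h⟩, hf, hpg⟩
  cases h
  let q' : Euc k → X := fun t => if h : t ∈ V then q ⟨t, h⟩ else q (c 0).1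
  have hq' : ∀ t : V, q' t = q t := fun t => by simp [q']
  have h1 : ContDiff ℝ ∞ fun t => ((c t).1 : Euc k) := IsPlot.contDiff (X := Euc k) hc.1
  have h2 : ContDiff ℝ ∞ fun t => (c t).2 := IsPlot.contDiff (X := Euc k) hc.2
  refine ⟨k, q', fun t => (c (f t)).1, fun t => (c (f t)).2,
    PlotNear.of_dSmooth hVo hq hq' (c (f x)).1.2, (SmoothNear.of_contDiff h1).comp hf,
    (SmoothNear.of_contDiff h2).comp hf, ?_⟩
  filter_upwards [hpg] with t ht
  rw [ht]
  exact tangentMap_eq hVo hVc hq hq' _ rfl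

/-- The map of tangent bundles induced by a smooth map. -/
def tangentBdMap (f : X → Y) (hf : DSmooth f) (z : TangentBd X) : TangentBd Y :=
  ⟨f z.1, TangentSp.map f hf rfl z.2⟩

theorem tangentBdMap_mk {f : X → Y} (hf : DSmooth f) {x : X} {y : Y} (hxy : f x = y)
    (v : TangentSp X x) : tangentBdMap f hf ⟨x, v⟩ = ⟨y, TangentSp.map f hf hxy v⟩ := by
  subst hxy; rfl

theorem hectorDiffeology_le_induced (f : X → Y) (hf : DSmooth f) :
    hectorDiffeology X ≤ inducedDiffeology (tangentBdMap f hf) (hectorDiffeology Y) := by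
  refine DiffeologicalSpace.generateFrom_le_iff.2 ?_
  rintro n p ⟨k, V, hVo, hVc, q, hq, l, c, hc, h⟩
  cases h
  refine DiffeologicalSpace.isPlot_generatedFrom_of_mem ?_
  refine ⟨k, V, hVo, hVc, fun t => f (q t), hf.comp hq, n, c, hc, ?_⟩
  congr 1
  funext t
  exact congrArg (Sigma.mk (f (q (c t).1))) (TangentSp.map_mk f hf rfl _ _)

theorem hectorDiffeology_le_proj :
    hectorDiffeology X ≤ inducedDiffeology (fun z : TangentBd X => z.1) d := by
  refine DiffeologicalSpace.generateFrom_le_iff.2 ?_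
  rintro n p ⟨k, V, hVo, hVc, q, hq, l, c, hc, h⟩
  cases h
  exact hq n (fun t => (c t).1) hc.1

end Hector

/-! ### Transport along the plots of the base of a bundle -/

section Bundle

variable {E : Type u} {B : Type v} {F : Type w} [dE : DiffeologicalSpace E]
  [dB : DiffeologicalSpace B] [DiffeologicalSpace F] {π : E → B}

/-- A local trivialization of the pullback of a bundle along a plot `q`, with the fiber eliminated:
`τ x x' z` is the point over `q x'` that has the same fiber coordinate as `z`, which lies over
`q x`. -/
theorem IsDiffeologicalBundle.exists_transport (hπ : IsDiffeologicalBundle F π) {n : ℕ}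
    {q : Euc n → B} {x₀ : Euc n} (hq : PlotNear dB q x₀) :
    ∃ W ∈ 𝓝 x₀, ∃ τ : Euc n → Euc n → E → E,
      (∀ x ∈ W, ∀ x' ∈ W, ∀ z, π z = q x → π (τ x x' z) = q x') ∧
      (∀ x ∈ W, ∀ z, π z = q x → τ x x z = z) ∧
      ∀ {m : ℕ} {x x' : Euc m → Euc n} {z : Euc m → E} {t₀ : Euc m}, SmoothNear x t₀ →
        SmoothNear x' t₀ → PlotNear dE z t₀ → x t₀ ∈ W → x' t₀ ∈ W →
        (∀ᶠ t in 𝓝 t₀, π (z t) = q (x t)) → PlotNear dE (fun t => τ (x t) (x' t) (z t)) t₀ := by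
  classical
  obtain ⟨ε, hε, -, hqε⟩ := hq.exists_dSmooth univ_mem
  obtain ⟨W₀, hW₀, hxW₀, φ, hφ, hφ', hφ1⟩ :=
    hπ.locallyTrivial n (ball x₀ ε) isOpen_ball _ hqε ⟨x₀, mem_ball_self hε⟩
  let W : Set (Euc n) := {x | ∃ h : x ∈ ball x₀ ε, (⟨x, h⟩ : ball x₀ ε) ∈ W₀}
  have hWo : IsOpen W := by
    have : W = Subtype.val '' W₀ := by ext x; simp [W]
    rw [this]
    exact isOpen_ball.isOpenMap_subtype_val _ hW₀
  let Z : ∀ x z, x ∈ W → π z = q x →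
      {z : {z : ball x₀ ε × E // q z.1 = π z.2} // z.1.1 ∈ W₀} :=
    fun x z h h' => ⟨⟨(⟨x, h.1⟩, z), h'.symm⟩, h.2⟩
  let S : ∀ x, x ∈ W → {s : ball x₀ ε // s ∈ W₀} := fun x h => ⟨⟨x, h.1⟩, h.2⟩
  let τ : Euc n → Euc n → E → E := fun x x' z =>
    if h : x ∈ W ∧ x' ∈ W ∧ π z = q x then
      (φ.symm (S x' h.2.1, (φ (Z x z h.1 h.2.2)).2)).1.1.2 else z
  have hτ : ∀ x x' z (h : x ∈ W ∧ x' ∈ W ∧ π z = q x),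
      τ x x' z = (φ.symm (S x' h.2.1, (φ (Z x z h.1 h.2.2)).2)).1.1.2 :=
    fun x x' z h => dif_pos h
  refine ⟨W, hWo.mem_nhds ⟨mem_ball_self hε, hxW₀⟩, τ, fun x hx x' hx' z hz => ?_,
    fun x hx z hz => ?_, fun {m x x' z t₀} hx hx' hz hxW hxW' hzx => ?_⟩
  · rw [hτ x x' z ⟨hx, hx', hz⟩]
    have h1 := hφ1 (φ.symm (S x' hx', (φ (Z x z hx hz)).2))
    rw [φ.apply_symm_apply] at h1
    refine (Subtype.property (Subtype.val (φ.symm (S x' hx', (φ (Z x z hx hz)).2)))).symm.trans ?_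
    exact congrArg (fun y : ball x₀ ε => q y) h1.symm
  · rw [hτ x x z ⟨hx, hx, hz⟩]
    have h1 : S x hx = (φ (Z x z hx hz)).1 := Subtype.ext (hφ1 (Z x z hx hz)).symm
    rw [h1, Prod.mk.eta, φ.symm_apply_apply]
  · have hev : ∀ᶠ t in 𝓝 t₀, (x t ∈ W ∧ x' t ∈ W ∧ π (z t) = q (x t)) ∧ ContDiffAt ℝ ∞ x t ∧
        ContDiffAt ℝ ∞ x' t ∧ PlotNear dE z t :=
      ((hx.continuousAt.eventually (hWo.mem_nhds hxW)).and
        ((hx'.continuousAt.eventually (hWo.mem_nhds hxW')).and hzx)).and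
        (hx.and (hx'.and hz.eventually))
    obtain ⟨χ, ψ, hχ, hψ, -, -, hχU, hχψ⟩ := exists_chart hev
    refine PlotNear.of_comp_chart hψ hχψ (PlotNear.of_isPlot ?_)
    have h1 : IsPlot fun t => x (χ t) := ContDiff.isPlot (X := Euc n) <|
      contDiff_iff_contDiffAt.2 fun t => (hχU t).2.1.comp t hχ.contDiffAt
    have h2 : IsPlot fun t => x' (χ t) := ContDiff.isPlot (X := Euc n) <|
      contDiff_iff_contDiffAt.2 fun t => (hχU t).2.2.1.comp t hχ.contDiffAt
    have h3 : IsPlot fun t => z (χ t) := PlotNear.isPlot fun t =>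
      (hχU t).2.2.2.comp (SmoothNear.of_contDiff hχ)
    have h4 : IsPlot fun t => Z (x (χ t)) (z (χ t)) (hχU t).1.1 (hχU t).1.2.2 := ⟨h1, h3⟩
    have h5 : IsPlot fun t => (S (x' (χ t)) (hχU t).1.2.1,
        (φ (Z (x (χ t)) (z (χ t)) (hχU t).1.1 (hχU t).1.2.2)).2) := ⟨h2, (hφ _ _ h4).2⟩
    have h6 := (hφ' _ _ h5).2
    refine cast (congrArg _ (funext fun t => ?_)) h6
    exact (hτ _ _ _ (hχU t).1).symm

/-- A smooth family of tangent vectors `q_* (v t)` of a plot `q` of the base lifts to the tangent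
bundle of the total space, along any plot `s` over the base points `q (c t)`. With a transport `τ`
along `q`, the lift consists of the tangent vectors `(v t, 0)` at `(c t, t)` of the plot
`Q (x, t) = τ (c t) x (s t)`, which lies over `q x` and satisfies `Q (c t, t) = s t`. -/
theorem IsDiffeologicalBundle.exists_lift (hπ : IsDiffeologicalBundle F π) {k m : ℕ}
    {q : Euc k → B} {c v : Euc m → Euc k} {s : Euc m → E} {t₀ : Euc m}
    (hq : PlotNear dB q (c t₀)) (hc : SmoothNear c t₀) (hv : SmoothNear v t₀)
    (hs : PlotNear dE s t₀) (hsq : ∀ᶠ t in 𝓝 t₀, π (s t) = q (c t)) :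
    ∃ w : ∀ t, TangentSp E (s t),
      PlotNear (hectorDiffeology E) (fun t => (⟨s t, w t⟩ : TangentBd E)) t₀ ∧
      ∀ᶠ t in 𝓝 t₀, ∀ (b : B) (hb : π (s t) = b),
        TangentSp.map π hπ.smooth hb (w t) = tan q (c t) b (v t) := by
  obtain ⟨W, hW, τ, hτπ, hτ1, hτs⟩ := hπ.exists_transport hq
  let e : Euc (k + m) ≃L[ℝ] Euc k × Euc m := EuclideanSpace.finAddEquivProd
  let Q : Euc (k + m) → E := fun y => τ (c (e y).2) (e y).1 (s (e y).2)
  let C : Euc m → Euc (k + m) := fun t => e.symm (c t, t)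
  let V : Euc m → Euc (k + m) := fun t => e.symm (v t, 0)
  have he1 : ContDiff ℝ ∞ fun y => (e y).1 := contDiff_fst.comp e.contDiff
  have he2 : ContDiff ℝ ∞ fun y => (e y).2 := contDiff_snd.comp e.contDiff
  have hC : SmoothNear C t₀ :=
    (SmoothNear.of_contDiff (f := e.symm) e.symm.contDiff).comp (hc.prodMk SmoothNear.id)
  have hV : SmoothNear V t₀ := (SmoothNear.of_contDiff (f := e.symm) e.symm.contDiff).comp
    (hv.prodMk (SmoothNear.const 0))
  have hC2 : (e (C t₀)).2 = t₀ := by simp [C]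
  have ht : Tendsto (fun y => (e y).2) (𝓝 (C t₀)) (𝓝 t₀) := by
    have := he2.continuous.tendsto (C t₀)
    rwa [hC2] at this
  have hQ : PlotNear dE Q (C t₀) := by
    refine hτs (hc.comp' (SmoothNear.of_contDiff he2) hC2) (SmoothNear.of_contDiff he1)
      (hs.comp' (SmoothNear.of_contDiff he2) hC2) ?_ ?_ (ht.eventually hsq)
    · rw [hC2]; exact mem_of_mem_nhds hW
    · simpa [C] using mem_of_mem_nhds hW
  have hcW : ∀ᶠ t in 𝓝 t₀, c t ∈ W := hc.continuousAt.eventually hW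
  have hQπ : ∀ᶠ y in 𝓝 (C t₀), π (Q y) = q (e y).1 := by
    have h1 : ∀ᶠ y in 𝓝 (C t₀), (e y).1 ∈ W :=
      he1.continuous.continuousAt.eventually (by simpa [C] using hW)
    filter_upwards [h1, ht.eventually hcW, ht.eventually hsq] with y h1 h2 h3
    exact hτπ _ h2 _ h1 _ h3
  have hQC : ∀ᶠ t in 𝓝 t₀, Q (C t) = s t := by
    filter_upwards [hcW, hsq] with t h1 h2
    simpa [Q, C] using hτ1 _ h1 _ h2
  refine ⟨fun t => tan Q (C t) (s t) (V t), plotNear_hector hQ hC hV hQC, ?_⟩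
  filter_upwards [hQC, hC.continuousAt.eventually hQ.eventually, hsq,
    hc.continuousAt.eventually hq.eventually,
    hC.continuousAt.eventually hQπ.eventually_nhds] with t h1 h2 h3 h4 h5 b hb
  rw [map_tan hπ.smooth hb h2 h1]
  rw [tan_comp h4 (f := fun y => (e y).1) (SmoothNear.of_contDiff he1) (by simp [C])
    (h3.symm.trans hb) h5]
  congr 1
  let pr : Euc (k + m) →L[ℝ] Euc k := (ContinuousLinearMap.fst ℝ (Euc k) (Euc m)).comp
    e.toContinuousLinearMap
  have h6 : HasFDerivAt (fun y => (e y).1) pr (C t) := pr.hasFDerivAt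
  rw [h6.fderiv]
  simp [V, pr]

end Bundle

/-! ### The dvs diffeology -/

section Dvs

theorem sigma_mk_eqRec {X : Type u} {V : X → Type w} {z z' : Σ x, V x} (h : z'.1 = z.1) :
    (⟨z.1, h ▸ z'.2⟩ : Σ x, V x) = z' := by
  obtain ⟨x, v⟩ := z
  obtain ⟨x', v'⟩ := z'
  dsimp only at h
  subst h
  rfl

variable {X : Type u} [d : DiffeologicalSpace X] {Y : Type v} [d' : DiffeologicalSpace Y]

theorem isDVSOver_induced_proj :
    IsDVSOver (inducedDiffeology (fun z : TangentBd X => z.1) d) where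
  proj _ _ hp := hp
  zero _ _ hp := hp
  add _ _ hp := hp.1
  smul _ _ hp := hp.2

theorem hectorDiffeology_le_dvs : hectorDiffeology X ≤ dvsDiffeology X :=
  le_sInf fun _ hd => hd.1

/-- The dvs diffeology makes the tangent bundle a diffeological vector space over `X`. For the
smoothness of the projection one needs that some diffeology containing Hector's does so, and the
one induced by the projection does. -/
theorem isDVSOver_dvs : IsDVSOver (dvsDiffeology X) where
  proj _ _ hp := DiffeologicalSpace.isPlot_sInf_iff.1 hp _
    ⟨hectorDiffeology_le_proj, isDVSOver_induced_proj⟩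
  zero n p hp := DiffeologicalSpace.isPlot_sInf_iff.2 fun _ hD => hD.2.zero n p hp
  add n p hp := DiffeologicalSpace.isPlot_sInf_iff.2 fun D hD => hD.2.add n p
    ⟨DiffeologicalSpace.isPlot_sInf_iff.1 hp.1 D hD,
      DiffeologicalSpace.isPlot_sInf_iff.1 hp.2 D hD⟩
  smul n p hp := DiffeologicalSpace.isPlot_sInf_iff.2 fun D hD => hD.2.smul n p
    ⟨hp.1, DiffeologicalSpace.isPlot_sInf_iff.1 hp.2 D hD⟩

namespace IsDVSOver

variable {D : DiffeologicalSpace (TangentBd X)} {n : ℕ} {s : Euc n → X} {t₀ : Euc n}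

theorem plotNear_zero (hD : IsDVSOver D) (hs : PlotNear d s t₀) :
    PlotNear D (fun t => (⟨s t, 0⟩ : TangentBd X)) t₀ :=
  hs.map (f := fun x => (⟨x, 0⟩ : TangentBd X)) hD.zero

theorem plotNear_add (hD : IsDVSOver D) {w w' : ∀ t, TangentSp X (s t)}
    (hw : PlotNear D (fun t => (⟨s t, w t⟩ : TangentBd X)) t₀)
    (hw' : PlotNear D (fun t => (⟨s t, w' t⟩ : TangentBd X)) t₀) :
    PlotNear D (fun t => (⟨s t, w t + w' t⟩ : TangentBd X)) t₀ := by
  obtain ⟨χ, ψ, hχ, hψ, -, -, hχU, hχψ⟩ := exists_chart (hw.eventually.and hw'.eventually)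
  refine PlotNear.of_comp_chart hψ hχψ (PlotNear.of_isPlot ?_)
  exact hD.add n
    (fun t => ⟨((⟨s (χ t), w (χ t)⟩ : TangentBd X), (⟨s (χ t), w' (χ t)⟩ : TangentBd X)), rfl⟩)
    ⟨PlotNear.isPlot fun t => (hχU t).1.comp (SmoothNear.of_contDiff hχ),
      PlotNear.isPlot fun t => (hχU t).2.comp (SmoothNear.of_contDiff hχ)⟩

theorem plotNear_smul (hD : IsDVSOver D) {w : ∀ t, TangentSp X (s t)} {r : Euc n → ℝ}
    (hr : PlotNear inferInstance r t₀)
    (hw : PlotNear D (fun t => (⟨s t, w t⟩ : TangentBd X)) t₀) :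
    PlotNear D (fun t => (⟨s t, r t • w t⟩ : TangentBd X)) t₀ := by
  obtain ⟨χ, ψ, hχ, hψ, -, -, hχU, hχψ⟩ := exists_chart (hr.eventually.and hw.eventually)
  refine PlotNear.of_comp_chart hψ hχψ (PlotNear.of_isPlot ?_)
  exact hD.smul n (fun t => (r (χ t), (⟨s (χ t), w (χ t)⟩ : TangentBd X)))
    ⟨PlotNear.isPlot fun t => (hχU t).1.comp (SmoothNear.of_contDiff hχ),
      PlotNear.isPlot fun t => (hχU t).2.comp (SmoothNear.of_contDiff hχ)⟩

end IsDVSOver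

/-- The tangent bundle map is smooth for the dvs diffeologies: the diffeology on `TX` induced by
the projection to `X` and the map to `TY` is one of those in the infimum defining the dvs
diffeology of `TX`. -/
theorem dvsDiffeology_le_induced (f : X → Y) (hf : DSmooth f) :
    dvsDiffeology X ≤ inducedDiffeology (tangentBdMap f hf) (dvsDiffeology Y) := by
  let D : DiffeologicalSpace (TangentBd X) :=
    inducedDiffeology (fun z : TangentBd X => (z.1, tangentBdMap f hf z))
      (@prodDiffeology X (TangentBd Y) d (dvsDiffeology Y))
  have hmap : ∀ {x x' : X} (h : x' = x) (v : TangentSp X x'),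
      TangentSp.map f hf rfl (h ▸ v) = congrArg f h ▸ TangentSp.map f hf rfl v := by
    intro x x' h v
    subst h
    rfl
  have hD : dvsDiffeology X ≤ D := by
    refine sInf_le ⟨DiffeologicalSpace.le_iff'.2 fun n p hp => ⟨?_, ?_⟩, ?_⟩
    · exact DiffeologicalSpace.le_iff'.1 hectorDiffeology_le_proj n p hp
    · exact DiffeologicalSpace.le_iff'.1 hectorDiffeology_le_dvs n _
        (DiffeologicalSpace.le_iff'.1 (hectorDiffeology_le_induced f hf) n p hp)
    · refine ⟨fun n p hp => hp.1, fun n p hp => ⟨hp, ?_⟩,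
        fun n p hp => ⟨hp.1.1, ?_⟩, fun n p hp => ⟨hp.2.1, ?_⟩⟩
      · have h1 := isDVSOver_dvs.zero n _ (hf n p hp)
        refine cast (congrArg _ (funext fun t => ?_)) h1
        simp [tangentBdMap]
      · have h1 := isDVSOver_dvs.add n (fun t => ⟨(tangentBdMap f hf (p t).1.1,
          tangentBdMap f hf (p t).1.2), congrArg f (p t).2⟩) ⟨hp.1.2, hp.2.2⟩
        refine cast (congrArg _ (funext fun t => ?_)) h1
        simp [tangentBdMap, hmap]
      · have h1 := isDVSOver_dvs.smul n (fun t => ((p t).1, tangentBdMap f hf (p t).2))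
          ⟨hp.1, hp.2.2⟩
        refine cast (congrArg _ (funext fun t => ?_)) h1
        simp [tangentBdMap]
  exact DiffeologicalSpace.le_iff'.2 fun n p hp => (DiffeologicalSpace.le_iff'.1 hD n p hp).2

end Dvs

/-! ### Lifting plots of the dvs diffeology -/

section Lifting

variable {E : Type u} {B : Type v} {F : Type w} [dE : DiffeologicalSpace E]
  [dB : DiffeologicalSpace B] [DiffeologicalSpace F] {π : E → B}

/-- A germ at `t₀` of functions to `TB` is liftable if, after any smooth reparametrization `g`, it
lifts to a germ of dvs plots of `TE` along every germ of plots `s` of `E` over its base points. -/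
def IsLiftableAt (hπ : DSmooth π) {n : ℕ} (p : Euc n → TangentBd B) (t₀ : Euc n) : Prop :=
  ∀ ⦃m : ℕ⦄ (g : Euc m → Euc n) (s : Euc m → E) (u₀ : Euc m), SmoothNear g u₀ → g u₀ = t₀ →
    PlotNear dE s u₀ → (∀ᶠ u in 𝓝 u₀, π (s u) = (p (g u)).1) →
    ∃ w : ∀ u, TangentSp E (s u),
      PlotNear (dvsDiffeology E) (fun u => (⟨s u, w u⟩ : TangentBd E)) u₀ ∧
      ∀ᶠ u in 𝓝 u₀, tangentBdMap π hπ ⟨s u, w u⟩ = p (g u)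

namespace IsLiftableAt

variable {hπ : DSmooth π} {n : ℕ} {p : Euc n → TangentBd B} {t₀ : Euc n}

theorem congr (h : IsLiftableAt hπ p t₀) {q : Euc n → TangentBd B} (hq : q =ᶠ[𝓝 t₀] p) :
    IsLiftableAt hπ q t₀ := by
  intro m g s u₀ hg hgu hs hsq
  have hq' : ∀ᶠ u in 𝓝 u₀, q (g u) = p (g u) := hg.continuousAt.eventually (by rwa [hgu])
  obtain ⟨w, h1, h2⟩ := h g s u₀ hg hgu hs (by
    filter_upwards [hsq, hq'] with u h1 h2
    rw [h1, h2])
  refine ⟨w, h1, ?_⟩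
  filter_upwards [h2, hq'] with u h1 h2
  rw [h1, h2]

theorem comp {m : ℕ} {f : Euc m → Euc n} {x : Euc m} (h : IsLiftableAt hπ p (f x))
    (hf : SmoothNear f x) : IsLiftableAt hπ (fun t => p (f t)) x := by
  intro k g s u₀ hg hgu hs hsq
  exact h (fun u => f (g u)) s u₀ (hf.comp' hg hgu) (congrArg f hgu) hs hsq

theorem zero (β : Euc n → B) : IsLiftableAt hπ (fun t => (⟨β t, 0⟩ : TangentBd B)) t₀ := by
  intro m g s u₀ hg hgu hs hsq
  refine ⟨fun _ => 0, isDVSOver_dvs.plotNear_zero hs, ?_⟩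
  filter_upwards [hsq] with u hu
  rw [tangentBdMap_mk hπ hu, map_zero]

theorem add {β : Euc n → B} {w w' : ∀ t, TangentSp B (β t)}
    (h : IsLiftableAt hπ (fun t => (⟨β t, w t⟩ : TangentBd B)) t₀)
    (h' : IsLiftableAt hπ (fun t => (⟨β t, w' t⟩ : TangentBd B)) t₀) :
    IsLiftableAt hπ (fun t => (⟨β t, w t + w' t⟩ : TangentBd B)) t₀ := by
  intro m g s u₀ hg hgu hs hsq
  obtain ⟨a, h1, h2⟩ := h g s u₀ hg hgu hs hsq
  obtain ⟨a', h1', h2'⟩ := h' g s u₀ hg hgu hs hsq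
  refine ⟨fun u => a u + a' u, isDVSOver_dvs.plotNear_add h1 h1', ?_⟩
  filter_upwards [hsq, h2, h2'] with u hu h3 h4
  rw [tangentBdMap_mk hπ hu] at h3 h4 ⊢
  rw [map_add, eq_of_heq (Sigma.mk.inj h3).2, eq_of_heq (Sigma.mk.inj h4).2]

theorem smul {β : Euc n → B} {w : ∀ t, TangentSp B (β t)} {r : Euc n → ℝ}
    (hr : PlotNear inferInstance r t₀)
    (h : IsLiftableAt hπ (fun t => (⟨β t, w t⟩ : TangentBd B)) t₀) :
    IsLiftableAt hπ (fun t => (⟨β t, r t • w t⟩ : TangentBd B)) t₀ := by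
  intro m g s u₀ hg hgu hs hsq
  obtain ⟨a, h1, h2⟩ := h g s u₀ hg hgu hs hsq
  refine ⟨fun u => r (g u) • a u, isDVSOver_dvs.plotNear_smul (hr.comp' hg hgu) h1, ?_⟩
  filter_upwards [hsq, h2] with u hu h3
  rw [tangentBdMap_mk hπ hu] at h3 ⊢
  rw [map_smul, eq_of_heq (Sigma.mk.inj h3).2]

theorem of_tan (hπ : IsDiffeologicalBundle F π) {k : ℕ} {q : Euc k → B} {c v : Euc n → Euc k}
    (hq : PlotNear dB q (c t₀)) (hc : SmoothNear c t₀) (hv : SmoothNear v t₀) :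
    IsLiftableAt hπ.smooth
      (fun t => (⟨q (c t), tan q (c t) (q (c t)) (v t)⟩ : TangentBd B)) t₀ := by
  intro m g s u₀ hg hgu hs hsq
  subst hgu
  obtain ⟨w, h1, h2⟩ := hπ.exists_lift (c := fun u => c (g u)) (v := fun u => v (g u)) hq
    (hc.comp hg) (hv.comp hg) hs hsq
  refine ⟨w, h1.map (f := id) (DiffeologicalSpace.le_iff'.1 hectorDiffeology_le_dvs), ?_⟩
  filter_upwards [hsq, h2] with u hu h3
  rw [tangentBdMap_mk hπ.smooth hu, h3 _ hu]

theorem const (hπ : IsDiffeologicalBundle F π) (z : TangentBd B) :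
    IsLiftableAt hπ.smooth (fun _ : Euc n => z) t₀ := by
  obtain ⟨b, v⟩ := z
  induction v using TangentSp.induction with
  | zero => exact zero _
  | mk P a =>
    obtain ⟨p, hp, hp0, hPp⟩ := P.exists_extension
    have h : (⟨b, TangentSp.mk P a⟩ : TangentBd B) = ⟨p 0, tan p 0 (p 0) a⟩ := by
      rw [hp0, mk_eq_tan (p := p) (c := 0) (fun t => by rw [zero_add, hPp]) a]
    rw [h]
    exact of_tan hπ (c := fun _ => 0) (v := fun _ => a) hp (SmoothNear.const _)
      (SmoothNear.const _)
  | add v w hv hw => exact hv.add hw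

end IsLiftableAt

/-- Every plot of the dvs diffeology of the base is liftable, because the functions to `TB` with
liftable germs form a diffeology that contains Hector's and makes `TB` a diffeological vector space
over `B`. -/
theorem IsDiffeologicalBundle.isLiftableAt (hπ : IsDiffeologicalBundle F π) {n : ℕ}
    {p : Euc n → TangentBd B} (hp : @IsPlot _ (dvsDiffeology B) n p) (t₀ : Euc n) :
    IsLiftableAt hπ.smooth p t₀ := by
  let D : DiffeologicalSpace (TangentBd B) := germDiffeology
    (fun {n} p x => PlotNear dB (fun t : Euc n => (p t).1) x ∧ IsLiftableAt hπ.smooth p x)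
    (fun h hq => ⟨h.1.congr (hq.fun_comp Sigma.fst), h.2.congr hq⟩)
    (fun a x => ⟨PlotNear.const _, IsLiftableAt.const hπ a⟩)
    (fun h hf => ⟨h.1.comp hf, h.2.comp hf⟩)
  have hD : dvsDiffeology B ≤ D := by
    refine sInf_le ⟨DiffeologicalSpace.le_iff'.2 fun n p hp x => ⟨?_, ?_⟩, ?_⟩
    · exact PlotNear.of_isPlot (DiffeologicalSpace.le_iff'.1 hectorDiffeology_le_proj n p hp)
    · rcases isPlot_hector hp x with ⟨a, ha⟩ | ⟨k, q, c, v, hq, hc, hv, h⟩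
      · exact (IsLiftableAt.const hπ a).congr ha
      · exact (IsLiftableAt.of_tan hπ hq hc hv).congr h
    · refine ⟨fun n p hp => PlotNear.isPlot fun t => (hp t).1,
        fun n p hp x => ⟨PlotNear.of_isPlot hp, IsLiftableAt.zero _⟩,
        fun n p hp x => ⟨(hp.1 x).1, ?_⟩, fun n p hp x => ⟨(hp.2 x).1, ?_⟩⟩
      · refine IsLiftableAt.add (hp.1 x).2 ?_
        have h1 : (fun t => (⟨(p t).1.1.1, (p t).2 ▸ (p t).1.2.2⟩ : TangentBd B)) =
            fun t => (p t).1.2 := funext fun t => sigma_mk_eqRec (p t).2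
        rw [h1]
        exact (hp.2 x).2
      · exact IsLiftableAt.smul (PlotNear.of_isPlot hp.1) (hp.2 x).2
  exact (DiffeologicalSpace.le_iff'.1 hD n p hp t₀).2

end Lifting

/-! ### Exactness -/

section Exactness

theorem IsGermHom.comp {X : Type u} {n m k : ℕ} {p : Euc n → X} {q : Euc m → X} {r : Euc k → X}
    {f : Euc n → Euc m} {g : Euc m → Euc k} (hf : IsGermHom p q f) (hg : IsGermHom q r g) :
    IsGermHom p r fun t => g (f t) := by
  refine ⟨hg.smooth.comp' hf.smooth hf.map_zero, by simp [hf.map_zero, hg.map_zero], ?_⟩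
  have h1 : Tendsto f (𝓝 0) (𝓝 0) := by
    have := hf.smooth.continuousAt.tendsto
    rwa [hf.map_zero] at this
  exact hf.comm.trans (h1.eventually hg.comm)

/-- A germ of plots of `E` with values in a fiber is a germ of plots of the fiber. -/
theorem exists_fiber_plot {E : Type u} {B : Type v} [dE : DiffeologicalSpace E] {π : E → B} {e : E}
    {b : B} (hb : π e = b) {n : ℕ} {k : Euc n → E} (hk : PlotNear dE k 0)
    (hk0 : k 0 = e) (hkb : ∀ᶠ t in 𝓝 0, π (k t) = b) :
    ∃ K : Euc n → {z : E // π z = b}, PlotNear inferInstance K 0 ∧ K 0 = ⟨e, hb⟩ ∧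
      ∀ᶠ t in 𝓝 0, (K t).1 = k t := by
  classical
  let K : Euc n → {z : E // π z = b} := fun t => if h : π (k t) = b then ⟨k t, h⟩ else ⟨e, hb⟩
  have hK : ∀ᶠ t in 𝓝 0, (K t).1 = k t := hkb.mono fun t ht => by simp [K, ht]
  have h1 : PlotNear dE (fun t => (K t).1) 0 := hk.congr hK
  exact ⟨K, h1, Subtype.ext (hK.self_of_nhds.trans hk0), hK⟩

variable {E : Type u} {B : Type v} {F : Type w} [dE : DiffeologicalSpace E]
  [dB : DiffeologicalSpace B] [DiffeologicalSpace F] {π : E → B} {e : E} {b : B}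

theorem IsDiffeologicalBundle.surjective_map (hπ : IsDiffeologicalBundle F π) (hb : π e = b) :
    Function.Surjective (TangentSp.map π hπ.smooth hb) := by
  intro v
  induction v using TangentSp.induction with
  | zero => exact ⟨0, map_zero _⟩
  | mk P a =>
    obtain ⟨p, hp, hp0, hPp⟩ := P.exists_extension
    obtain ⟨w, -, h⟩ := hπ.exists_lift (m := 0) (c := fun _ => 0) (v := fun _ => a)
      (s := fun _ => e) (t₀ := 0) hp (SmoothNear.const _) (SmoothNear.const _) (PlotNear.const e)
      (Eventually.of_forall fun _ => hb.trans hp0.symm)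
    refine ⟨w 0, (h.self_of_nhds b hb).trans ?_⟩
    exact (mk_eq_tan (fun t => by rw [zero_add, hPp]) a).symm
  | add v w hv hw =>
    obtain ⟨v, rfl⟩ := hv
    obtain ⟨w, rfl⟩ := hw
    exact ⟨v + w, map_add _ _ _⟩

theorem TangentSp.map_comp_fiber_inclusion (hπ : DSmooth π) (hb : π e = b)
    (v : TangentSp {z : E // π z = b} ⟨e, hb⟩) :
    map π hπ hb (map Subtype.val (dSmooth_val fun z => π z = b) rfl v) = 0 := by
  induction v using TangentSp.induction with
  | zero => rw [map_zero, map_zero]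
  | mk P a =>
    refine (congrArg _ (map_mk _ _ _ P a)).trans ((map_mk _ _ _ _ _).trans ?_)
    have h1 := mk_eq_tan (P := (P.push Subtype.val (dSmooth_val fun z => π z = b) rfl).push π hπ hb)
      (p := fun _ => b) (c := 0) (fun t => (P.toFun t).2) a
    exact h1.trans (tan_const _ _ _)
  | add v w hv hw => rw [map_add, map_add, hv, hw, add_zero]

/-- A vector `p_* a` killed by `π_*` is killed by a morphism `f` from `π ∘ p` to a plot of `B`. With
the transport `τ` along that plot, `p` is the composite of `P (x, u) = τ (f u) x (p u)` with the
graph `u ↦ (f u, u)`, whose derivative sends `a` to `(0, a)`; so `p_* a` is represented by the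
plot `u ↦ P (0, u)` of the fiber. -/
theorem IsDiffeologicalBundle.exists_of_map_eq_zero (hπ : IsDiffeologicalBundle F π)
    (hb : π e = b) (hE : IsFilteredAt E e) (hB : IsFilteredAt B b) {v : TangentSp E e}
    (hv : TangentSp.map π hπ.smooth hb v = 0) :
    ∃ w : TangentSp {z : E // π z = b} ⟨e, hb⟩,
      TangentSp.map Subtype.val (dSmooth_val fun z => π z = b) rfl w = v := by
  obtain ⟨n, p, a, hp, hp0, rfl⟩ := hE.exists_tan_eq v
  rw [map_tan hπ.smooth hb hp hp0] at hv
  obtain ⟨m, r, f, hr, hr0, hf, hfa⟩ := hB.exists_fderiv_eq_zero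
    (hp.map hπ.smooth) (by rw [hp0, hb]) hv
  obtain ⟨W, hW, τ, hτπ, hτ1, hτs⟩ := hπ.exists_transport hr
  have h0W : (0 : Euc m) ∈ W := mem_of_mem_nhds hW
  have hfW : ∀ᶠ u in 𝓝 0, f u ∈ W :=
    hf.smooth.continuousAt.eventually (by rwa [hf.map_zero])
  let ε : Euc (m + n) ≃L[ℝ] Euc m × Euc n := EuclideanSpace.finAddEquivProd
  let P : Euc (m + n) → E := fun y => τ (f (ε y).2) (ε y).1 (p (ε y).2)
  have he1 : ContDiff ℝ ∞ fun y => (ε y).1 := contDiff_fst.comp ε.contDiff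
  have he2 : ContDiff ℝ ∞ fun y => (ε y).2 := contDiff_snd.comp ε.contDiff
  have ht : Tendsto (fun y => (ε y).2) (𝓝 0) (𝓝 0) := by
    simpa using he2.continuous.tendsto 0
  have hP : PlotNear dE P 0 :=
    hτs (hf.smooth.comp' (SmoothNear.of_contDiff he2) (by simp)) (SmoothNear.of_contDiff he1)
      (hp.comp' (SmoothNear.of_contDiff he2) (by simp)) (by simpa [hf.map_zero] using h0W)
      (by simpa using h0W) (ht.eventually hf.comm)
  have hP0 : P 0 = e := by
    simp only [P, map_zero, Prod.fst_zero, Prod.snd_zero, hf.map_zero]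
    rw [hτ1 0 h0W _ (by rw [hp0, hb, hr0]), hp0]
  have hεs : ContDiff ℝ ∞ ε.symm := ε.symm.contDiff
  have hgraph : SmoothNear (fun u => ε.symm (f u, u)) 0 :=
    (SmoothNear.of_contDiff hεs).comp (hf.smooth.prodMk SmoothNear.id)
  let inr : Euc n →L[ℝ] Euc (m + n) :=
    ε.symm.toContinuousLinearMap.comp (ContinuousLinearMap.inr ℝ (Euc m) (Euc n))
  have hinr : ∀ u, inr u = ε.symm (0, u) := fun u => rfl
  -- The fiber plot `u ↦ P (0, u)`.
  have hk : PlotNear dE (fun u => P (inr u)) 0 :=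
    hP.comp' (SmoothNear.of_contDiff inr.contDiff) (map_zero inr)
  have hk0 : P (inr 0) = e := by rw [map_zero, hP0]
  obtain ⟨K, hK, hK0, hKk⟩ := exists_fiber_plot hb hk hk0 (by
    filter_upwards [hfW, hf.comm] with u h1 h2
    have := hτπ _ h1 0 h0W _ h2
    rw [hr0] at this
    simpa [P, hinr] using this)
  refine ⟨tan K 0 ⟨e, hb⟩ a, ?_⟩
  rw [map_tan _ _ hK hK0, tan_congr hk hk0 hKk,
    tan_comp hP (SmoothNear.of_contDiff inr.contDiff) (map_zero inr) hP0 EventuallyEq.rfl,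
    tan_comp hP hgraph (by simp [hf.map_zero]) hP0 (p := p)]
  · congr 1
    have h1 : HasFDerivAt (fun u => ε.symm (f u, u)) (ε.symm.toContinuousLinearMap.comp
        ((fderiv ℝ f 0).prod (ContinuousLinearMap.id ℝ (Euc n)))) 0 :=
      ε.symm.toContinuousLinearMap.hasFDerivAt.comp 0
        (hf.smooth.differentiableAt.hasFDerivAt.prodMk (hasFDerivAt_id _))
    rw [h1.fderiv, inr.fderiv, hinr]
    simp [hfa]
  · filter_upwards [hfW, hf.comm] with u h1 h2
    simpa [P] using (hτ1 _ h1 _ h2).symm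

/-- If `B` is filtered, then plots `p`, `q` of the fiber that map to a common plot `r` of `E` map
to a common plot of the fiber, by the same morphisms `f` and `g`. Indeed `f` and `g` are parallel
to the zero morphism between plots of `B`, so some `μ : π ∘ r → s` satisfies
`μ ∘ f = 0 = μ ∘ g`; moving `r` into the fiber along `s` does not change it where `μ = 0`. -/
theorem IsDiffeologicalBundle.exists_fiber_cocone (hπ : IsDiffeologicalBundle F π) (hb : π e = b)
    (hB : IsFilteredAt B b) {n m k : ℕ} {p : Euc n → {z : E // π z = b}}
    {q : Euc m → {z : E // π z = b}} {r : Euc k → E} {f : Euc n → Euc k} {g : Euc m → Euc k}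
    (hr : PlotNear dE r 0) (hr0 : r 0 = e) (hf : IsGermHom (fun t => (p t).1) r f)
    (hg : IsGermHom (fun t => (q t).1) r g) :
    ∃ K : Euc k → {z : E // π z = b}, PlotNear inferInstance K 0 ∧ K 0 = ⟨e, hb⟩ ∧
      IsGermHom p K f ∧ IsGermHom q K g := by
  have hzero : ∀ {n l : ℕ} {s : Euc l → B}, s 0 = b →
      IsGermHom (fun _ : Euc n => b) s fun _ => 0 :=
    fun hs => ⟨SmoothNear.const _, rfl, Eventually.of_forall fun _ => hs.symm⟩
  have hπr : PlotNear dB (fun t => π (r t)) 0 := hr.map hπ.smooth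
  have hπr0 : π (r 0) = b := by rw [hr0, hb]
  have hf' : IsGermHom (fun _ => b) (fun t => π (r t)) f :=
    ⟨hf.smooth, hf.map_zero, hf.comm.mono fun t ht => (p t).2.symm.trans (congrArg π ht)⟩
  have hg' : IsGermHom (fun _ => b) (fun t => π (r t)) g :=
    ⟨hg.smooth, hg.map_zero, hg.comm.mono fun t ht => (q t).2.symm.trans (congrArg π ht)⟩
  obtain ⟨k₁, s₁, μ₁, hs₁, hs₁0, hμ₁, hμf⟩ := hB.exists_coequalizer (PlotNear.const b) rfl hπr hπr0
    hf' (hzero hπr0)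
  obtain ⟨k₂, s, μ₂, hs, hs0, hμ₂, hμg⟩ := hB.exists_coequalizer (PlotNear.const b) rfl hs₁ hs₁0
    (hg'.comp hμ₁) (hzero hs₁0)
  have hμ := hμ₁.comp hμ₂
  have hμ0 : μ₂ (μ₁ 0) = 0 := hμ.map_zero
  obtain ⟨W, hW, τ, hτπ, hτ1, hτs⟩ := hπ.exists_transport hs
  have h0W : (0 : Euc k₂) ∈ W := mem_of_mem_nhds hW
  have hμW : ∀ᶠ v in 𝓝 0, μ₂ (μ₁ v) ∈ W :=
    hμ.smooth.continuousAt.eventually (by beta_reduce; rwa [hμ0])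
  have hK₀ : PlotNear dE (fun v => τ (μ₂ (μ₁ v)) 0 (r v)) 0 :=
    hτs hμ.smooth (SmoothNear.const 0) hr (by rwa [hμ0]) h0W hμ.comm
  obtain ⟨K, hK, hK0, hKk⟩ := exists_fiber_plot hb hK₀ (by
    rw [hμ0, hτ1 0 h0W _ (by rw [hπr0, hs0]), hr0]) (by
    filter_upwards [hμW, hμ.comm] with v h1 h2
    rw [hτπ _ h1 0 h0W _ h2, hs0])
  have key : ∀ {n : ℕ} {p : Euc n → {z : E // π z = b}} {f : Euc n → Euc k},
      IsGermHom (fun t => (p t).1) r f → (∀ᶠ t in 𝓝 0, μ₂ (μ₁ (f t)) = 0) →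
      IsGermHom p K f := by
    intro n p f hf h
    refine ⟨hf.smooth, hf.map_zero, ?_⟩
    have h1 : Tendsto f (𝓝 0) (𝓝 0) := by
      have := hf.smooth.continuousAt.tendsto
      rwa [hf.map_zero] at this
    filter_upwards [hf.comm, h, h1.eventually hKk] with t h2 h3 h4
    refine Subtype.ext ?_
    rw [h4, h3, hτ1 0 h0W _ (by rw [← h2, (p t).2, hs0])]
    exact h2
  refine ⟨K, hK, hK0, key hf ?_, key hg ?_⟩
  · filter_upwards [hμf] with t h1
    rw [h1, hμ₁.map_zero, hμ₂.map_zero]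
  · filter_upwards [hμg] with t h1
    rw [h1, hμ₂.map_zero]

theorem IsDiffeologicalBundle.exists_fiber_tan_eq (hπ : IsDiffeologicalBundle F π) (hb : π e = b)
    (hE : IsFilteredAt E e) (hB : IsFilteredAt B b)
    (v : TangentSp {z : E // π z = b} ⟨e, hb⟩) :
    ∃ (n : ℕ) (p : Euc n → {z : E // π z = b}) (a : Euc n),
      PlotNear inferInstance p 0 ∧ p 0 = ⟨e, hb⟩ ∧ tan p 0 ⟨e, hb⟩ a = v := by
  induction v using TangentSp.induction with
  | zero => exact ⟨0, fun _ => ⟨e, hb⟩, 0, PlotNear.const _, rfl, map_zero _⟩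
  | mk P a =>
    obtain ⟨p, hp, hp0, hPp⟩ := P.exists_extension
    exact ⟨P.dim, p, a, hp, hp0, (mk_eq_tan (fun t => by rw [zero_add, hPp]) a).symm⟩
  | add v w hv hw =>
    obtain ⟨n, p, a, hp, hp0, rfl⟩ := hv
    obtain ⟨m, q, c, hq, hq0, rfl⟩ := hw
    obtain ⟨k, r, f, g, hr, hr0, hf, hg⟩ := hE.exists_cocone
      (hp.map (dSmooth_val fun z => π z = b)) (congrArg Subtype.val hp0)
      (hq.map (dSmooth_val fun z => π z = b)) (congrArg Subtype.val hq0)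
    obtain ⟨K, hK, hK0, hf', hg'⟩ := hπ.exists_fiber_cocone hb hB hr hr0 hf hg
    refine ⟨k, K, fderiv ℝ f 0 a + fderiv ℝ g 0 c, hK, hK0, ?_⟩
    rw [map_add, ← hf'.tan_eq hK hK0, ← hg'.tan_eq hK hK0]

theorem IsDiffeologicalBundle.injective_map_fiber_inclusion (hπ : IsDiffeologicalBundle F π)
    (hb : π e = b) (hE : IsFilteredAt E e) (hB : IsFilteredAt B b) :
    Function.Injective (TangentSp.map (x := (⟨e, hb⟩ : {z : E // π z = b})) (y := e) Subtype.val
      (dSmooth_val fun z => π z = b) rfl) := by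
  refine (injective_iff_map_eq_zero _).2 fun v hv => ?_
  obtain ⟨n, p, a, hp, hp0, rfl⟩ := hπ.exists_fiber_tan_eq hb hE hB v
  rw [map_tan _ _ hp hp0] at hv
  obtain ⟨k, r, f, hr, hr0, hf, hfa⟩ := hE.exists_fderiv_eq_zero
    (hp.map (dSmooth_val fun z => π z = b)) (congrArg Subtype.val hp0) hv
  obtain ⟨K, hK, hK0, hf', -⟩ := hπ.exists_fiber_cocone hb hB hr hr0 hf hf
  rw [hf'.tan_eq hK hK0, hfa, map_zero]

end Exactness

/-! ### Subductions -/

section Subduction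

theorem IsSubduction.of_lift {X : Type u} {Y : Type v} {dX : DiffeologicalSpace X}
    {dY : DiffeologicalSpace Y} {f : X → Y} (hf : DSmooth f)
    (hlift : ∀ (n : ℕ) (p : Euc n → Y), IsPlot p → ∀ t, ∃ q : Euc n → X,
      PlotNear dX q t ∧ ∀ᶠ s in 𝓝 t, f (q s) = p s) : IsSubduction dX dY f := by
  refine fun n p => ⟨fun hp t => ?_, fun h => PlotNear.isPlot fun t => ?_⟩
  · obtain ⟨q, hq, hqp⟩ := hlift n p hp t
    obtain ⟨ε, hε, hb, hqε⟩ := hq.exists_dSmooth hqp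
    exact ⟨ball t ε, isOpen_ball, mem_ball_self hε, fun s => q s, hqε, fun s => hb s.2⟩
  · obtain ⟨W, hW, ht, q, hq, hqp⟩ := h t
    exact PlotNear.of_dSmooth hW (hf.comp hq) (fun s => (hqp s).symm) ht

variable {E : Type u} {B : Type v} {F : Type w} [dE : DiffeologicalSpace E]
  [dB : DiffeologicalSpace B] [DiffeologicalSpace F] {π : E → B} {e : E} {b : B}

theorem IsDiffeologicalBundle.isSubduction_hectorAt (hπ : IsDiffeologicalBundle F π)
    (hb : π e = b) :
    IsSubduction (hectorAt e) (hectorAt b) (TangentSp.map π hπ.smooth hb) := by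
  refine IsSubduction.of_lift (fun n p hp => ?_) fun n p hp t => ?_
  · have h1 : @IsPlot _ (hectorDiffeology B) n fun t => tangentBdMap π hπ.smooth ⟨e, p t⟩ :=
      DiffeologicalSpace.le_iff'.1 (hectorDiffeology_le_induced π hπ.smooth) n _ hp
    simp only [tangentBdMap_mk hπ.smooth hb] at h1
    exact h1
  · rcases isPlot_hector hp t with ⟨a, ha⟩ | ⟨k, q, c, v, hq, hc, hv, h⟩
    · -- Constant functions are Hector plots even when the vector is not of the form `q_* v`.
      obtain ⟨w, hw⟩ := hπ.surjective_map hb (p t)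
      refine ⟨fun _ => w, PlotNear.const _, ?_⟩
      filter_upwards [ha] with s hs
      rw [hw]
      exact (eq_of_heq (Sigma.mk.inj (hs.trans ha.self_of_nhds.symm)).2).symm
    · obtain ⟨w, h1, h2⟩ := hπ.exists_lift (s := fun _ => e) hq hc hv (PlotNear.const e)
        (h.mono fun s hs => hb.trans (congrArg Sigma.fst hs))
      refine ⟨w, h1, ?_⟩
      filter_upwards [h, h2] with s h3 h4
      have h5 : b = q (c s) := congrArg Sigma.fst h3
      rw [h4 b hb]
      have h6 : (⟨b, tan q (c s) b (v s)⟩ : TangentBd B) =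
          ⟨q (c s), tan q (c s) (q (c s)) (v s)⟩ := by rw [← h5]
      exact eq_of_heq (Sigma.mk.inj (h6.trans h3.symm)).2

theorem IsDiffeologicalBundle.isSubduction_dvsAt (hπ : IsDiffeologicalBundle F π)
    (hb : π e = b) :
    IsSubduction (dvsAt e) (dvsAt b) (TangentSp.map π hπ.smooth hb) := by
  refine IsSubduction.of_lift (fun n p hp => ?_) fun n p hp t => ?_
  · have h1 : @IsPlot _ (dvsDiffeology B) n fun t => tangentBdMap π hπ.smooth ⟨e, p t⟩ :=
      DiffeologicalSpace.le_iff'.1 (dvsDiffeology_le_induced π hπ.smooth) n _ hp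
    simp only [tangentBdMap_mk hπ.smooth hb] at h1
    exact h1
  · obtain ⟨w, h1, h2⟩ := hπ.isLiftableAt hp t (fun u => u) (fun _ => e) t SmoothNear.id rfl
      (PlotNear.const e) (Eventually.of_forall fun _ => hb)
    refine ⟨w, h1, ?_⟩
    filter_upwards [h2] with s hs
    rw [tangentBdMap_mk hπ.smooth hb] at hs
    exact eq_of_heq (Sigma.mk.inj hs).2

end Subduction

end DiffTangent

end

theorem theorem4p6 {E : Type*} {B : Type*} {F : Type*} [DiffeologicalSpace E]
    [DiffeologicalSpace B] [DiffeologicalSpace F] (π : E → B)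
    (hπ : DiffTangent.IsDiffeologicalBundle F π) (e : E) (b : B) (hb : π e = b)
    (hE : DiffTangent.IsFilteredAt E e) (hB : DiffTangent.IsFilteredAt B b) :
    let Fb : Type _ := {z : E // π z = b}
    let ι : Fb → E := Subtype.val
    let ιT : DiffTangent.TangentSp Fb ⟨e, hb⟩ →ₗ[ℝ] DiffTangent.TangentSp E e :=
      DiffTangent.TangentSp.map ι (DiffTangent.dSmooth_val fun z => π z = b) rfl
    let πT : DiffTangent.TangentSp E e →ₗ[ℝ] DiffTangent.TangentSp B b :=
      DiffTangent.TangentSp.map π hπ.smooth hb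
    Function.Injective ιT ∧ Function.Exact ιT πT ∧ Function.Surjective πT ∧
      DiffTangent.IsSubduction (DiffTangent.hectorAt e) (DiffTangent.hectorAt b) πT ∧
      DiffTangent.IsSubduction (DiffTangent.dvsAt e) (DiffTangent.dvsAt b) πT := by
  intro Fb ι ιT πT
  refine ⟨hπ.injective_map_fiber_inclusion hb hE hB,
    fun v => ⟨hπ.exists_of_map_eq_zero hb hE hB, ?_⟩, hπ.surjective_map hb,
    hπ.isSubduction_hectorAt hb, hπ.isSubduction_dvsAt hb⟩
  rintro ⟨w, rfl⟩
  exact DiffTangent.TangentSp.map_comp_fiber_inclusion hπ.smooth hb w
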